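/- All graphs are finite, simple and undirected. For graphs $F$, $G$, $H$ write $G\to(F,H)$ if every red/blue coloring of the edges of $G$ contains a red copy of $F$ or a blue copy of $H$ (as a not necessarily induced subgraph). For fixed $F$ and $H$, $(F,H)$-Arrowing is the decision problem: given a graph $G$ (encoded as a bit string by its number of vertices in unary and its adjacency matrix), does $G\to(F,H)$ hold? A decision problem is coNP-hard if every language in coNP reduces to it by a polynomial-time many-one reduction. A connected graph is 2-connected if it has more than 2 vertices and remains connected whenever fewer than 2 vertices are removed. $K_{1,n}$ denotes the star on $n+1$ vertices. Lemma. Let $H$ be a 2-connected graph and let $n\ge 3$ be an integer. If $(K_{1,k},H)$-Arrowing is coNP-hard for every integer $k$ with $2\le k<n$, then $(K_{1,n},H)$-Arrowing is coNP-hard. -/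

import Mathlib

/-! ### Graph theory -/

/-- A graph is `k`-connected if it is connected, has more than `k` vertices, and stays connected
whenever fewer than `k` vertices are removed. -/
def SimpleGraph.IsKConnected {W : Type*} [Fintype W] (k : ℕ) (H : SimpleGraph W) : Prop :=
  H.Connected ∧ k < Fintype.card W ∧
    ∀ S : Finset W, S.card < k → (H.induce {v | v ∉ S}).Connected

/-- The two colors of an edge coloring. -/
inductive EdgeColor where
  | red
  | blue

/-- `G → (F, H)`: every red/blue coloring of the edges of `G` contains a red copy of `F` or a blue
copy of `H` (as a not necessarily induced subgraph). Here `c.labelGraph a` is the graph on the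
vertices of `G` formed by the edges of color `a`. -/
def SimpleGraph.Arrows {V U W : Type*} (G : SimpleGraph V) (F : SimpleGraph U)
    (H : SimpleGraph W) : Prop :=
  ∀ c : G.EdgeLabeling EdgeColor,
    F.IsContained (c.labelGraph EdgeColor.red) ∨ H.IsContained (c.labelGraph EdgeColor.blue)

/-- The star `K_{1,n}`. -/
abbrev starK (n : ℕ) : SimpleGraph (Fin 1 ⊕ Fin n) :=
  completeBipartiteGraph (Fin 1) (Fin n)

/-! ### Inputs: finite graphs, encoded as bit strings -/

/-- A finite graph with vertex set `{0, …, N - 1}`, for some `N`. -/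
abbrev FinGraph : Type := Σ N : ℕ, SimpleGraph (Fin N)

open Classical in
/-- The adjacency matrix of a graph on `Fin N`, row by row, as a string of `N * N` bits. -/
noncomputable def adjBits {N : ℕ} (G : SimpleGraph (Fin N)) : List Bool :=
  (List.finRange N).flatMap fun i => (List.finRange N).map fun j => decide (G.Adj i j)

/-- The bit string encoding a finite graph: the number `N` of vertices in unary, terminated by a
zero, followed by the adjacency matrix. -/
noncomputable def encodeGraph (G : FinGraph) : List Bool :=
  List.replicate G.1 true ++ false :: adjBits G.2

/-! ### Complexity classes

Polynomial-time computability is Mathlib's `Turing.TM2ComputableInPolyTime`: computability by a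
(multi-stack) Turing machine whose number of steps is bounded by a polynomial in the length of the
encoded input. -/

/-- The encoding of a pair of bit strings, the two components being separated by `none`. -/
def encodePair (p : List Bool × List Bool) : List (Option Bool) :=
  p.1.map some ++ none :: p.2.map some

/-- The class NP: `L` has a polynomial-time verifier with certificates of polynomial length. -/
def InNP (L : Set (List Bool)) : Prop :=
  ∃ (p : Polynomial ℕ) (V : List Bool × List Bool → Bool),
    Nonempty (Turing.TM2ComputableInPolyTime encodePair Computability.encodeBool V) ∧
      ∀ x, x ∈ L ↔ ∃ w : List Bool, w.length ≤ p.eval x.length ∧ V (x, w) = true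

/-- The class coNP: complements of languages in NP. -/
def InCoNP (L : Set (List Bool)) : Prop := InNP Lᶜ

/-- A decision problem, given by the predicate `P` ("yes-instance") on instances `α` that are
encoded by `enc`, is coNP-hard if every language in coNP is polynomial-time many-one reducible
to it. -/
def IsCoNPHard {α : Type} (enc : α → List Bool) (P : α → Prop) : Prop :=
  ∀ L : Set (List Bool), InCoNP L →
    ∃ f : List Bool → α,
      Nonempty (Turing.TM2ComputableInPolyTime (id : List Bool → List Bool) enc f) ∧
        ∀ x, x ∈ L ↔ P (f x)

/-- `(F, H)`-Arrowing is coNP-hard: for the fixed graphs `F` and `H`, it is coNP-hard to decide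
whether a given finite graph `G` satisfies `G → (F, H)`. -/
def ArrowingIsCoNPHard {U W : Type*} (F : SimpleGraph U) (H : SimpleGraph W) : Prop :=
  IsCoNPHard encodeGraph fun G : FinGraph => G.2.Arrows F H

/-! ### The encodings determine the encoded objects -/

theorem encodePair_injective : Function.Injective encodePair := by
  rintro ⟨x, w⟩ ⟨x', w'⟩ h
  simp only [encodePair] at h
  induction x generalizing x' with
  | nil =>
    cases x' with
    | nil =>
      have := List.map_injective_iff.2 (Option.some_injective Bool) (by simpa using h)
      simp [this]
    | cons b x' => simp at h
  | cons a x ih =>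
    cases x' with
    | nil => simp at h
    | cons b x' =>
      simp only [List.map_cons, List.cons_append, List.cons.injEq, Option.some.injEq] at h
      have := ih x' h.2
      simp only [Prod.mk.injEq] at this ⊢
      exact ⟨by rw [h.1, this.1], this.2⟩

theorem flatMap_inj_of_length {α β : Type*} (k : ℕ) (l : List α) (f g : α → List β)
    (hf : ∀ a, (f a).length = k) (hg : ∀ a, (g a).length = k)
    (h : l.flatMap f = l.flatMap g) : ∀ a ∈ l, f a = g a := by
  induction l with
  | nil => simp
  | cons a l ih =>
    simp only [List.flatMap_cons] at h
    obtain ⟨h1, h2⟩ := List.append_inj h (by rw [hf, hg])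
    intro b hb
    rcases List.mem_cons.1 hb with rfl | hb
    · exact h1
    · exact ih h2 b hb

theorem adjBits_injective {N : ℕ} : Function.Injective (adjBits (N := N)) := by
  intro G G' h
  have h1 := flatMap_inj_of_length N _ _ _ (by simp) (by simp) h
  ext i j
  have h2 := List.map_inj_left.1 (h1 i (List.mem_finRange i)) j (List.mem_finRange j)
  simpa using h2

theorem encodeGraph_injective : Function.Injective encodeGraph := by
  have key : ∀ (m n : ℕ) (s t : List Bool),
      List.replicate m true ++ false :: s = List.replicate n true ++ false :: t →
        m = n ∧ s = t := by
    intro m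
    induction m with
    | zero => intro n s t h; cases n <;> simp_all [List.replicate_succ]
    | succ m ih =>
      intro n s t h
      cases n with
      | zero => simp [List.replicate_succ] at h
      | succ n =>
        simp only [List.replicate_succ, List.cons_append, List.cons.injEq, true_and] at h
        have := ih n s t h
        exact ⟨by omega, this.2⟩
  rintro ⟨m, G⟩ ⟨n, G'⟩ h
  obtain ⟨h1, h2⟩ := key _ _ _ _ h
  dsimp only at h1 h2
  subst h1
  rw [adjBits_injective h2]

/-! Call a coloring good if it has neither a red $K_{1,n}$ nor a blue $H$. The reduction hangs a
fixed rooted gadget on every vertex of the input $G$. Suppose the root has at least $m$ red edges in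
every good coloring of the gadget, and exactly $m$ in some. Then each vertex keeps room for fewer
than $n-m$ red edges inside $G$, and no copy of the 2-connected $H$ straddles a root
(`free_attach`). So the new graph arrows $(K_{1,n},H)$ iff $G$ arrows $(K_{1,n-m},H)$
(`IsGadget.arrows_attach_iff`), which is a usable reduction once $1\le m\le n-2$.

To find a gadget, remove an edge $uv$ from an edge-minimal graph that arrows $(K_{1,n},H)$. Good
colorings now exist, but none extends by a red $uv$, so each one puts $n-1$ red edges on $u$ or on
$v$ (`exists_or_saturated`). If $u$ always has a red edge, take $u$ as root. Otherwise some good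
coloring has no red edge at $u$; join more than $|H|$ copies in a ring, the $v$ of each copy being
the $u$ of the next. Repeating that coloring around the ring is good, because $H$ is too small to go
round and lies in one copy (`free_ring`). Conversely, each copy saturates one of its two joints and
no joint can be saturated twice, so every good coloring saturates all joints
(`le_ncard_neighborSet_of_ring`).

The value $m=n-1$ is too large. In that case hang the gadget on all vertices of $H$ except the ends
of one edge $vw$: all other edges of $H$ are forced blue, hence $vw$ is red, and $v$ is a root with
$m=1$ (`IsGadget.exists_one`).

Polynomial time refers to multi-stack machines, so the reduction needs closure under composition
(`TM2ComputableInPolyTime.comp`) and an explicit machine that attaches gadgets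
(`nonempty_computableInPolyTime_attachFin`). The latter uses that, with vertices grouped by gadget
vertex, the adjacency matrix consists of $N\times N$ blocks: one is the matrix of $G$, the others
are zero or the identity. -/

/-! ### Composition of polynomial-time computable functions -/

namespace StateTransition

/-- `f` leads from `a` to `b` in exactly `n` steps. -/
def ReachesIn {σ : Type*} (f : σ → Option σ) (n : ℕ) (a b : σ) : Prop :=
  (flip bind f)^[n] (some a) = some b

namespace ReachesIn

variable {σ τ : Type*} {f : σ → Option σ} {a b c : σ} {m n : ℕ}

theorem single (h : f a = some b) : ReachesIn f 1 a b := h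

theorem trans (hab : ReachesIn f m a b) (hbc : ReachesIn f n b c) :
    ReachesIn f (m + n) a c := by
  unfold ReachesIn at *
  rw [Nat.add_comm, Function.iterate_add_apply, hab, hbc]

theorem head (h : f a = some b) (hbc : ReachesIn f n b c) : ReachesIn f (n + 1) a c := by
  rw [Nat.add_comm]
  exact (single h).trans hbc

theorem iterate_none (f : σ → Option σ) (n : ℕ) : (flip bind f)^[n] none = none := by
  induction n with
  | zero => rfl
  | succ n ih => rw [Function.iterate_succ_apply]; exact ih

theorem succ_iff : ReachesIn f (n + 1) a c ↔ ∃ b, f a = some b ∧ ReachesIn f n b c := by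
  constructor
  · intro h
    unfold ReachesIn at h
    rw [Function.iterate_succ_apply] at h
    change (flip bind f)^[n] (f a) = some c at h
    cases hb : f a with
    | none => rw [hb, iterate_none] at h; cases h
    | some b => exact ⟨b, rfl, by rw [hb] at h; exact h⟩
  · rintro ⟨b, h, hbc⟩
    exact head h hbc

theorem map {g : τ → Option τ} (e : σ → τ)
    (he : ∀ x y, f x = some y → g (e x) = some (e y)) (h : ReachesIn f n a b) :
    ReachesIn g n (e a) (e b) := by
  induction n generalizing a with
  | zero => cases h; rfl
  | succ n ih =>
    obtain ⟨c, hac, hcb⟩ := succ_iff.1 h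
    exact head (he _ _ hac) (ih hcb)

/-- The computation that witnesses `EvalsToInTime`. -/
theorem evalsToInTime (h : ReachesIn f n a b) (hn : n ≤ m) :
    Nonempty (EvalsToInTime f a (some b) m) :=
  ⟨⟨⟨n, h⟩, hn⟩⟩

end ReachesIn

end StateTransition

namespace Turing

open StateTransition Function

/-! ### Growth of the stacks during a run -/

namespace TM2

variable {K : Type*} {Γ : K → Type*} {Λ σ : Type*}

/-- The number of push instructions in a statement. -/
def Stmt.pushes : Stmt Γ Λ σ → ℕ
  | push _ _ q => q.pushes + 1
  | peek _ _ q => q.pushes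
  | pop _ _ q => q.pushes
  | load _ q => q.pushes
  | branch _ q₁ q₂ => q₁.pushes + q₂.pushes
  | goto _ => 0
  | halt => 0

variable [DecidableEq K]

theorem length_stepAux_le (q : Stmt Γ Λ σ) (v : σ) (S : ∀ k, List (Γ k)) (k : K) :
    ((stepAux q v S).stk k).length ≤ (S k).length + q.pushes := by
  induction q generalizing v S with
  | push j f q ih =>
    refine (ih _ _).trans ?_
    rw [Stmt.pushes]
    by_cases h : k = j
    · subst h; simp; omega
    · rw [update_of_ne h]; omega
  | peek j f q ih => exact ih _ _
  | pop j f q ih =>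
    refine (ih _ _).trans ?_
    rw [Stmt.pushes]
    by_cases h : k = j
    · subst h; simp
    · rw [update_of_ne h]
  | load f q ih => exact ih _ _
  | branch f q₁ q₂ ih₁ ih₂ =>
    rw [stepAux, Stmt.pushes]
    have := ih₁ v S
    have := ih₂ v S
    cases f v <;> simp <;> omega
  | goto f => simp
  | halt => simp

/-- In a composition, the second machine's running time is measured in the length of the
intermediate string; this controls that length by the time spent writing it. -/
theorem length_le_of_reachesIn {M : Λ → Stmt Γ Λ σ} {d : ℕ} (hd : ∀ l, (M l).pushes ≤ d)
    {n : ℕ} {a b : Cfg Γ Λ σ} (h : ReachesIn (step M) n a b) (k : K) :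
    (b.stk k).length ≤ (a.stk k).length + d * n := by
  induction n generalizing a with
  | zero => cases h; simp
  | succ n ih =>
    obtain ⟨c, hac, hcb⟩ := ReachesIn.succ_iff.1 h
    refine (ih hcb).trans ?_
    obtain ⟨_ | l, v, S⟩ := a
    · cases hac
    · have h1 := length_stepAux_le (M l) v S k
      have h2 := hd l
      cases hac
      rw [Nat.mul_succ]
      dsimp only at *
      omega

end TM2

theorem initList_eq (tm : FinTM2) (s : List (tm.Γ tm.k₀)) :
    initList tm s = ⟨some tm.main, tm.initialState, update (fun _ => []) tm.k₀ s⟩ := by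
  unfold initList
  congr 1
  funext k
  by_cases h : k = tm.k₀
  · subst h; simp
  · rw [dif_neg h, update_of_ne h]

theorem haltList_eq (tm : FinTM2) (s : List (tm.Γ tm.k₁)) :
    haltList tm s = ⟨none, tm.initialState, update (fun _ => []) tm.k₁ s⟩ := by
  unfold haltList
  congr 1
  funext k
  by_cases h : k = tm.k₁
  · subst h; simp
  · rw [dif_neg h, update_of_ne h]

/-! ### The machine that runs two machines in succession -/

namespace FinTM2.Comp

variable (M₁ M₂ : FinTM2) (β : Type)

/-- The alphabets of the composed machine: those of both machines, and `β` for an additional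
stack. -/
abbrev Alphabet : Option (M₁.K ⊕ M₂.K) → Type
  | none => β
  | some (.inl k) => M₁.Γ k
  | some (.inr k) => M₂.Γ k

/-- The labels of the composed machine; the two additional ones are for moving the output of the
first machine to the input of the second. -/
abbrev Label : Type := M₁.Λ ⊕ Bool ⊕ M₂.Λ

/-- The states of the composed machine. -/
abbrev State : Type := M₁.σ × M₂.σ × Option β

variable {M₁ M₂ β}

/-- The stacks of the composed machine, from those of its two parts and the additional one. -/
def glue (S₁ : ∀ k, List (M₁.Γ k)) (l : List β) (S₂ : ∀ k, List (M₂.Γ k)) :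
    ∀ k, List (Alphabet M₁ M₂ β k)
  | none => l
  | some (.inl k) => S₁ k
  | some (.inr k) => S₂ k

@[simp] theorem update_glue_left (S₁ : ∀ k, List (M₁.Γ k)) (l : List β)
    (S₂ : ∀ k, List (M₂.Γ k)) (k : M₁.K) (x : List (M₁.Γ k)) :
    update (glue S₁ l S₂) (some (.inl k)) x = glue (update S₁ k x) l S₂ := by
  funext j
  rcases j with _ | j | j
  · rw [update_of_ne (by simp)]; rfl
  · by_cases h : j = k
    · subst h; simp [glue]
    · rw [update_of_ne (by simpa using h)]; simp [glue, update_of_ne h]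
  · rw [update_of_ne (by simp)]; rfl

@[simp] theorem update_glue_right (S₁ : ∀ k, List (M₁.Γ k)) (l : List β)
    (S₂ : ∀ k, List (M₂.Γ k)) (k : M₂.K) (x : List (M₂.Γ k)) :
    update (glue S₁ l S₂) (some (.inr k)) x = glue S₁ l (update S₂ k x) := by
  funext j
  rcases j with _ | j | j
  · rw [update_of_ne (by simp)]; rfl
  · rw [update_of_ne (by simp)]; rfl
  · by_cases h : j = k
    · subst h; simp [glue]
    · rw [update_of_ne (by simpa using h)]; simp [glue, update_of_ne h]

@[simp] theorem update_glue_none (S₁ : ∀ k, List (M₁.Γ k)) (l : List β)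
    (S₂ : ∀ k, List (M₂.Γ k)) (x : List β) :
    update (glue S₁ l S₂) none x = glue S₁ x S₂ := by
  funext j
  rcases j with _ | j | j
  · rw [update_self]; rfl
  · rw [update_of_ne (by simp)]; rfl
  · rw [update_of_ne (by simp)]; rfl

/-- A statement of the first machine, as a statement of the composed machine. -/
def stmtLeft : TM2.Stmt M₁.Γ M₁.Λ M₁.σ →
    TM2.Stmt (Alphabet M₁ M₂ β) (Label M₁ M₂) (State M₁ M₂ β)
  | .push k f q => .push (some (.inl k)) (fun s => f s.1) (stmtLeft q)
  | .peek k f q => .peek (some (.inl k)) (fun s x => (f s.1 x, s.2)) (stmtLeft q)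
  | .pop k f q => .pop (some (.inl k)) (fun s x => (f s.1 x, s.2)) (stmtLeft q)
  | .load f q => .load (fun s => (f s.1, s.2)) (stmtLeft q)
  | .branch f q₁ q₂ => .branch (fun s => f s.1) (stmtLeft q₁) (stmtLeft q₂)
  | .goto f => .goto fun s => .inl (f s.1)
  -- Halting turns into a jump to the transfer loop, so the simulation takes exactly as many steps
  -- as the first machine.
  | .halt => .goto fun _ => .inr (.inl true)

/-- A statement of the second machine, as a statement of the composed machine. -/
def stmtRight : TM2.Stmt M₂.Γ M₂.Λ M₂.σ →
    TM2.Stmt (Alphabet M₁ M₂ β) (Label M₁ M₂) (State M₁ M₂ β)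
  | .push k f q => .push (some (.inr k)) (fun s => f s.2.1) (stmtRight q)
  | .peek k f q => .peek (some (.inr k)) (fun s x => (s.1, f s.2.1 x, s.2.2)) (stmtRight q)
  | .pop k f q => .pop (some (.inr k)) (fun s x => (s.1, f s.2.1 x, s.2.2)) (stmtRight q)
  | .load f q => .load (fun s => (s.1, f s.2.1, s.2.2)) (stmtRight q)
  | .branch f q₁ q₂ => .branch (fun s => f s.2.1) (stmtRight q₁) (stmtRight q₂)
  | .goto f => .goto fun s => .inr (.inr (f s.2.1))
  | .halt => .halt

/-- A configuration of the first machine, as a configuration of the composed machine. -/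
def cfgLeft (v₂ : M₂.σ) (r : Option β) (l : List β) (S₂ : ∀ k, List (M₂.Γ k)) (c : M₁.Cfg) :
    TM2.Cfg (Alphabet M₁ M₂ β) (Label M₁ M₂) (State M₁ M₂ β) :=
  ⟨some (c.l.elim (.inr (.inl true)) .inl), (c.var, v₂, r), glue c.stk l S₂⟩

/-- A configuration of the second machine, as a configuration of the composed machine. -/
def cfgRight (v₁ : M₁.σ) (r : Option β) (l : List β) (S₁ : ∀ k, List (M₁.Γ k)) (c : M₂.Cfg) :
    TM2.Cfg (Alphabet M₁ M₂ β) (Label M₁ M₂) (State M₁ M₂ β) :=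
  ⟨c.l.map fun l => .inr (.inr l), (v₁, c.var, r), glue S₁ l c.stk⟩

theorem stepAux_stmtLeft (q : TM2.Stmt M₁.Γ M₁.Λ M₁.σ) (v₁ : M₁.σ) (S₁ : ∀ k, List (M₁.Γ k))
    (v₂ : M₂.σ) (r : Option β) (l : List β) (S₂ : ∀ k, List (M₂.Γ k)) :
    TM2.stepAux (stmtLeft q) (v₁, v₂, r) (glue S₁ l S₂) =
      cfgLeft v₂ r l S₂ (TM2.stepAux q v₁ S₁) := by
  induction q generalizing v₁ S₁ with
  | push k f q ih => simp only [stmtLeft, TM2.stepAux, update_glue_left]; exact ih _ _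
  | peek k f q ih => exact ih _ _
  | pop k f q ih => simp only [stmtLeft, TM2.stepAux, update_glue_left]; exact ih _ _
  | load f q ih => exact ih _ _
  | branch f q₁ q₂ ih₁ ih₂ =>
    simp only [stmtLeft, TM2.stepAux]
    cases f v₁
    · exact ih₂ _ _
    · exact ih₁ _ _
  | goto f => rfl
  | halt => rfl

theorem stepAux_stmtRight (q : TM2.Stmt M₂.Γ M₂.Λ M₂.σ) (v₂ : M₂.σ) (S₂ : ∀ k, List (M₂.Γ k))
    (v₁ : M₁.σ) (r : Option β) (l : List β) (S₁ : ∀ k, List (M₁.Γ k)) :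
    TM2.stepAux (stmtRight q) (v₁, v₂, r) (glue S₁ l S₂) =
      cfgRight v₁ r l S₁ (TM2.stepAux q v₂ S₂) := by
  induction q generalizing v₂ S₂ with
  | push k f q ih => simp only [stmtRight, TM2.stepAux, update_glue_right]; exact ih _ _
  | peek k f q ih => exact ih _ _
  | pop k f q ih => simp only [stmtRight, TM2.stepAux, update_glue_right]; exact ih _ _
  | load f q ih => exact ih _ _
  | branch f q₁ q₂ ih₁ ih₂ =>
    simp only [stmtRight, TM2.stepAux]
    cases f v₂
    · exact ih₂ _ _
    · exact ih₁ _ _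
  | goto f => rfl
  | halt => rfl

variable [Inhabited β] (e₁ : M₁.Γ M₁.k₁ ≃ β) (e₂ : M₂.Γ M₂.k₀ ≃ β)

/-- The program of the composed machine. -/
def program : Label M₁ M₂ → TM2.Stmt (Alphabet M₁ M₂ β) (Label M₁ M₂) (State M₁ M₂ β)
  | .inl l => stmtLeft (M₁.m l)
  -- Unloading one stack onto another reverses it, so the string passes through the additional stack
  -- to be reversed twice. `default` is never pushed, since `isSome` has been checked.
  | .inr (.inl true) =>
    .pop (some (.inl M₁.k₁)) (fun s x => (s.1, s.2.1, Option.map e₁ x)) <|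
      .branch (fun s => s.2.2.isSome)
        (.push none (fun s => s.2.2.getD default) <| .goto fun _ => .inr (.inl true))
        (.goto fun _ => .inr (.inl false))
  | .inr (.inl false) =>
    .pop none (fun s x => (s.1, s.2.1, x)) <|
      .branch (fun s => s.2.2.isSome)
        (.push (some (.inr M₂.k₀)) (fun s => e₂.symm (s.2.2.getD default)) <|
          .goto fun _ => .inr (.inl false))
        (.goto fun _ => .inr (.inr M₂.main))
  | .inr (.inr l) => stmtRight (M₂.m l)

theorem reachesIn_left {n : ℕ} {a b : M₁.Cfg} (h : ReachesIn M₁.step n a b) (v₂ : M₂.σ)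
    (r : Option β) (l : List β) (S₂ : ∀ k, List (M₂.Γ k)) :
    ReachesIn (TM2.step (program e₁ e₂)) n (cfgLeft v₂ r l S₂ a) (cfgLeft v₂ r l S₂ b) := by
  refine h.map _ fun x y hxy => ?_
  obtain ⟨_ | l', v, S⟩ := x
  · cases hxy
  · cases hxy
    exact congrArg some (stepAux_stmtLeft _ _ _ _ _ _ _)

theorem reachesIn_right {n : ℕ} {a b : M₂.Cfg} (h : ReachesIn M₂.step n a b) (v₁ : M₁.σ)
    (r : Option β) (l : List β) (S₁ : ∀ k, List (M₁.Γ k)) :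
    ReachesIn (TM2.step (program e₁ e₂)) n (cfgRight v₁ r l S₁ a) (cfgRight v₁ r l S₁ b) := by
  refine h.map _ fun x y hxy => ?_
  obtain ⟨_ | l', v, S⟩ := x
  · cases hxy
  · cases hxy
    exact congrArg some (stepAux_stmtRight _ _ _ _ _ _ _)

theorem reachesIn_move_output (w : List (M₁.Γ M₁.k₁)) (v₁ : M₁.σ) (v₂ : M₂.σ) (r : Option β)
    (l : List β) (S₁ : ∀ k, List (M₁.Γ k)) (S₂ : ∀ k, List (M₂.Γ k)) :
    ReachesIn (TM2.step (program e₁ e₂)) (w.length + 1)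
      ⟨some (.inr (.inl true)), (v₁, v₂, r), glue (update S₁ M₁.k₁ w) l S₂⟩
      ⟨some (.inr (.inl false)), (v₁, v₂, none),
        glue (update S₁ M₁.k₁ []) ((w.map e₁).reverse ++ l) S₂⟩ := by
  induction w generalizing l r with
  | nil =>
    refine .single ?_
    simp [program, glue]
  | cons x w ih =>
    have h := ih (some (e₁ x)) (e₁ x :: l)
    rw [show ∀ y, (List.map y (x :: w)).reverse ++ l = (List.map y w).reverse ++ y x :: l by simp]
    exact .head (by simp [program, glue]) h

theorem reachesIn_move_input (w : List β) (v₁ : M₁.σ) (v₂ : M₂.σ) (r : Option β)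
    (l : List (M₂.Γ M₂.k₀)) (S₁ : ∀ k, List (M₁.Γ k)) (S₂ : ∀ k, List (M₂.Γ k)) :
    ReachesIn (TM2.step (program e₁ e₂)) (w.length + 1)
      ⟨some (.inr (.inl false)), (v₁, v₂, r), glue S₁ w (update S₂ M₂.k₀ l)⟩
      ⟨some (.inr (.inr M₂.main)), (v₁, v₂, none),
        glue S₁ [] (update S₂ M₂.k₀ ((w.map e₂.symm).reverse ++ l))⟩ := by
  induction w generalizing l r with
  | nil =>
    refine .single ?_
    simp [program, glue]
  | cons x w ih =>
    have h := ih (some x) (e₂.symm x :: l)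
    rw [show ∀ y, (List.map y (x :: w)).reverse ++ l = (List.map y w).reverse ++ y x :: l by simp]
    exact .head (by simp [program, glue]) h

variable [Fintype β]

/-- The machine that runs `M₁`, moves its output to the input of `M₂` and runs `M₂`. -/
def machine : FinTM2 :=
  letI := M₁.kFin
  letI := M₂.kFin
  letI := M₁.ΛFin
  letI := M₂.ΛFin
  letI := M₁.σFin
  letI := M₂.σFin
  { K := Option (M₁.K ⊕ M₂.K)
    k₀ := some (.inl M₁.k₀)
    k₁ := some (.inr M₂.k₁)
    Γ := Alphabet M₁ M₂ β
    Λ := Label M₁ M₂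
    main := .inl M₁.main
    σ := State M₁ M₂ β
    initialState := (M₁.initialState, M₂.initialState, none)
    Γk₀Fin := M₁.Γk₀Fin
    m := program e₁ e₂ }

theorem reachesIn_machine {m n : ℕ} {x : List (M₁.Γ M₁.k₀)} {y : List (M₁.Γ M₁.k₁)}
    {z : List (M₂.Γ M₂.k₁)} (h₁ : ReachesIn M₁.step m (initList M₁ x) (haltList M₁ y))
    (h₂ : ReachesIn M₂.step n (initList M₂ (y.map fun b => e₂.symm (e₁ b))) (haltList M₂ z)) :
    ReachesIn (machine e₁ e₂).step (m + (y.length + 1) + (y.length + 1) + n)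
      (initList (machine e₁ e₂) x) (haltList (machine e₁ e₂) z) := by
  have key : ReachesIn (TM2.step (program e₁ e₂)) (m + (y.length + 1) + (y.length + 1) + n)
      ⟨some (.inl M₁.main), (M₁.initialState, M₂.initialState, none),
        glue (update (fun _ => []) M₁.k₀ x) [] (fun _ => [])⟩
      ⟨none, (M₁.initialState, M₂.initialState, none),
        glue (fun _ => []) [] (update (fun _ => []) M₂.k₁ z)⟩ := by
    rw [initList_eq, haltList_eq] at h₁ h₂
    have h3 := reachesIn_left e₁ e₂ h₁ M₂.initialState none [] (fun _ => [])
    have h4 := reachesIn_right e₁ e₂ h₂ M₁.initialState none [] (fun _ => [])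
    have h5 := reachesIn_move_output e₁ e₂ y M₁.initialState M₂.initialState none []
      (fun _ => []) (fun _ => [])
    have h6 := reachesIn_move_input e₁ e₂ (y.map e₁).reverse M₁.initialState M₂.initialState none
      [] (fun _ => []) (fun _ => [])
    have hu₁ : update (fun k => ([] : List (M₁.Γ k))) M₁.k₁ [] = fun _ => [] := by simp
    have hu₂ : update (fun k => ([] : List (M₂.Γ k))) M₂.k₀ [] = fun _ => [] := by simp
    rw [hu₁] at h5
    rw [hu₂] at h6
    simp only [List.append_nil, List.map_reverse, List.reverse_reverse, List.length_reverse,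
      List.length_map, List.map_map] at h5 h6
    exact ((h3.trans h5).trans h6).trans h4
  have e3 : (fun k => ([] : List (Alphabet M₁ M₂ β k))) =
      glue (fun _ => []) [] (fun _ => []) := by
    funext k; rcases k with _ | k | k <;> rfl
  have h7 : initList (machine e₁ e₂) x =
      ⟨some (.inl M₁.main), (M₁.initialState, M₂.initialState, none),
        glue (update (fun _ => []) M₁.k₀ x) [] (fun _ => [])⟩ := by
    rw [← update_glue_left, ← e3]
    exact initList_eq (machine e₁ e₂) x
  have h8 : haltList (machine e₁ e₂) z =
      ⟨none, (M₁.initialState, M₂.initialState, none),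
        glue (fun _ => []) [] (update (fun _ => []) M₂.k₁ z)⟩ := by
    rw [← update_glue_right, ← e3]
    exact haltList_eq (machine e₁ e₂) z
  exact h7 ▸ h8 ▸ key

end FinTM2.Comp

theorem EvalsToInTime.exists_reachesIn {σ : Type*} {f : σ → Option σ} {a b : σ} {m : ℕ}
    (h : EvalsToInTime f a (some b) m) : ∃ n ≤ m, ReachesIn f n a b :=
  ⟨h.steps, h.steps_le_m, h.evals_in_steps⟩

theorem eval_mono (p : Polynomial ℕ) : Monotone fun n => p.eval n := by
  intro a b h
  simp only [Polynomial.eval_eq_sum_range]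
  gcongr

/-- Polynomial-time computable functions are closed under composition. -/
theorem TM2ComputableInPolyTime.comp {α β γ αΓ βΓ γΓ : Type} [Fintype βΓ] [Inhabited βΓ]
    {ea : α → List αΓ} {eb : β → List βΓ} {ec : γ → List γΓ} {f : α → β} {g : β → γ}
    (hf : TM2ComputableInPolyTime ea eb f) (hg : TM2ComputableInPolyTime eb ec g) :
    Nonempty (TM2ComputableInPolyTime ea ec (g ∘ f)) := by
  classical
  let _ := hf.tm.ΛFin
  set d := ∑ l, (hf.tm.m l).pushes with hd
  have key : ∀ a, Nonempty (TM2OutputsInTime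
      (FinTM2.Comp.machine hf.outputAlphabet hg.inputAlphabet)
      ((ea a).map hf.inputAlphabet.invFun)
      (some ((ec (g (f a))).map hg.outputAlphabet.invFun))
      ((hf.time + 2 * (Polynomial.X + Polynomial.C d * hf.time + 1) +
        hg.time.comp (Polynomial.X + Polynomial.C d * hf.time)).eval (ea a).length)) := by
    intro a
    obtain ⟨m, hm, h₁⟩ := EvalsToInTime.exists_reachesIn (hf.outputsFun a)
    obtain ⟨n, hn, h₂⟩ := EvalsToInTime.exists_reachesIn (hg.outputsFun (f a))
    have hlen : (eb (f a)).length ≤ (ea a).length + d * hf.time.eval (ea a).length := by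
      have h := TM2.length_le_of_reachesIn (d := d)
        (fun l => Finset.single_le_sum (f := fun l => (hf.tm.m l).pushes)
          (fun _ _ => Nat.zero_le _) (Finset.mem_univ l)) h₁ hf.tm.k₁
      rw [initList_eq, haltList_eq] at h
      have h0 : (update (fun k => ([] : List (hf.tm.Γ k))) hf.tm.k₀
          ((ea a).map hf.inputAlphabet.invFun) hf.tm.k₁).length ≤ (ea a).length := by
        by_cases hk : hf.tm.k₁ = hf.tm.k₀
        · rw [hk]; simp
        · rw [update_of_ne hk]; simp
      simp only [update_self, List.length_map] at h
      have := Nat.mul_le_mul_left d hm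
      omega
    have h₂' : ReachesIn hg.tm.step n
        (initList hg.tm (((eb (f a)).map hf.outputAlphabet.invFun).map
          fun b => hg.inputAlphabet.symm (hf.outputAlphabet b)))
        (haltList hg.tm ((ec (g (f a))).map hg.outputAlphabet.invFun)) := by
      convert h₂ using 2
      simp
    refine (FinTM2.Comp.reachesIn_machine hf.outputAlphabet hg.inputAlphabet
      h₁ h₂').evalsToInTime ?_
    -- Natural coefficients make the time bound monotone, so the bound on the intermediate length
    -- can be substituted.
    have h3 := eval_mono hg.time hlen
    simp only [List.length_map, Polynomial.eval_add, Polynomial.eval_mul, Polynomial.eval_comp,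
      Polynomial.eval_X, Polynomial.eval_C, Polynomial.eval_ofNat, Polynomial.eval_one] at h3 ⊢
    omega
  exact ⟨{ tm := FinTM2.Comp.machine hf.outputAlphabet hg.inputAlphabet
           inputAlphabet := hf.inputAlphabet
           outputAlphabet := hg.outputAlphabet
           time := _
           outputsFun := fun a => (key a).some }⟩

end Turing

/-! ### A machine that writes the adjacency matrix of a graph with attached copies of a gadget -/

namespace StateTransition

/-- `f` leads from `a` to `b` in at most `n` steps. -/
def ReachesWithin {σ : Type*} (f : σ → Option σ) (n : ℕ) (a b : σ) : Prop :=
  ∃ m ≤ n, ReachesIn f m a b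

namespace ReachesWithin

variable {σ : Type*} {f : σ → Option σ} {a b c : σ} {m n : ℕ}

theorem refl (f : σ → Option σ) (a : σ) : ReachesWithin f 0 a a := ⟨0, le_rfl, rfl⟩

theorem trans (hab : ReachesWithin f m a b) (hbc : ReachesWithin f n b c) :
    ReachesWithin f (m + n) a c := by
  obtain ⟨m', hm, h₁⟩ := hab
  obtain ⟨n', hn, h₂⟩ := hbc
  exact ⟨m' + n', by omega, h₁.trans h₂⟩

theorem mono (h : ReachesWithin f m a b) (hmn : m ≤ n) : ReachesWithin f n a b := by
  obtain ⟨k, hk, h⟩ := h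
  exact ⟨k, hk.trans hmn, h⟩

theorem single (h : f a = some b) : ReachesWithin f 1 a b := ⟨1, le_rfl, h⟩

theorem head (h : f a = some b) (hbc : ReachesWithin f n b c) :
    ReachesWithin f (n + 1) a c :=
  ((single h).trans hbc).mono (by omega)

end ReachesWithin

end StateTransition

open StateTransition Turing

namespace AttachMachine

/-- The stacks of the machine. -/
inductive Stack
  | input
  | row
  | scratch
  | output
  deriving DecidableEq

instance : Fintype Stack :=
  ⟨{.input, .row, .scratch, .output}, fun k => by cases k <;> simp⟩

/-- The contents of all stacks. -/
def stk (i x y o : List Bool) : Stack → List Bool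
  | .input => i
  | .row => x
  | .scratch => y
  | .output => o

section

variable (i x y o l : List Bool)

@[simp] theorem stk_input : stk i x y o .input = i := rfl
@[simp] theorem stk_row : stk i x y o .row = x := rfl
@[simp] theorem stk_scratch : stk i x y o .scratch = y := rfl
@[simp] theorem stk_output : stk i x y o .output = o := rfl

@[simp] theorem update_stk_input : Function.update (stk i x y o) .input l = stk l x y o := by
  funext k; cases k <;> simp [stk, Function.update]
@[simp] theorem update_stk_row : Function.update (stk i x y o) .row l = stk i l y o := by
  funext k; cases k <;> simp [stk, Function.update]
@[simp] theorem update_stk_scratch :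
    Function.update (stk i x y o) .scratch l = stk i x l o := by
  funext k; cases k <;> simp [stk, Function.update]
@[simp] theorem update_stk_output : Function.update (stk i x y o) .output l = stk i x y l := by
  funext k; cases k <;> simp [stk, Function.update]

end

/-- The labels of the machine, for a gadget with `a` vertices. -/
inductive Label (a : ℕ)
  | parse
  | shift (p : Fin a)
  | unshift (p : Fin a)
  | emit (p q : Fin a)
  | unemit (p q : Fin a)
  | separator
  | finish
  deriving Fintype

/-- The states: a carry bit and two registers. -/
abbrev State : Type := Bool × Option Bool × Option Bool

variable {a : ℕ}

/-- The label at which the rows of the gadget vertices with number less than `k` are written. -/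
def rowsLabel : (k : ℕ) → k ≤ a → Label a
  | 0, _ => .separator
  | k + 1, h => .shift ⟨k, h⟩

/-- The label at which, within a row of gadget vertex `p`, the blocks of the gadget vertices with
number less than `k` are written. -/
def blocksLabel (p : Fin a) : (k : ℕ) → k ≤ a → Label a
  | 0, _ => .shift p
  | k + 1, h => .emit p ⟨k, h⟩

/-- `k` times the instruction to write `true` to the output. -/
def pushTrue {Λ : Type} :
    ℕ → TM2.Stmt (fun _ : Stack => Bool) Λ State → TM2.Stmt (fun _ : Stack => Bool) Λ State
  | 0, q => q
  | k + 1, q => .push .output (fun _ => true) (pushTrue k q)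

theorem stepAux_pushTrue {Λ : Type} (k : ℕ) (q : TM2.Stmt (fun _ : Stack => Bool) Λ State)
    (v : State) (i x y o : List Bool) :
    TM2.stepAux (pushTrue k q) v (stk i x y o) =
      TM2.stepAux q v (stk i x y (List.replicate k true ++ o)) := by
  induction k generalizing o with
  | zero => rfl
  | succ k ih =>
    rw [pushTrue, TM2.stepAux, update_stk_output, stk_output, ih]
    congr 2
    rw [List.replicate_succ', List.append_assoc]
    rfl

variable (A : ℕ → ℕ → Bool) (r : ℕ)

/-- The program. The stack `row` holds a unit vector, which is shifted by one position before
each row that is written; the carry bit shows that the vector was shifted out. -/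
def program : Label a → TM2.Stmt (fun _ : Stack => Bool) (Label a) State
  -- The row becomes the zero vector of length $N$; the initial carry `true` makes the first shift
  -- produce the unit vector at position 0.
  | .parse =>
    .pop .input (fun s x => (s.1, x, none)) <|
      .branch (fun s => s.2.1.getD false)
        (.push .row (fun _ => false) <| .goto fun _ => .parse)
        (.load (fun s => (s.1, none, none)) <| .goto fun _ => rowsLabel a le_rfl)
  | .shift p =>
    .pop .row (fun s x => (s.1, x, none)) <|
      .branch (fun s => s.2.1.isSome)
        (.push .scratch (fun s => s.1) <|
          .load (fun s => (s.2.1.getD false, none, none)) <| .goto fun _ => .shift p)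
        (.goto fun _ => .unshift p)
  | .unshift p =>
    .pop .scratch (fun s x => (s.1, x, none)) <|
      .branch (fun s => s.2.1.isSome)
        (.push .row (fun s => s.2.1.getD false) <| .goto fun _ => .unshift p)
        (.branch (fun s => s.1)
          (.goto fun _ => rowsLabel p.1 p.2.le) (.goto fun _ => blocksLabel p a le_rfl))
  -- Block $(r,r)$ is copied from the input. Any other block is `A p q` times the identity, so its
  -- current row is that multiple of the unit vector.
  | .emit p q =>
    .pop .row (fun s x => (s.1, x, none)) <|
      .branch (fun s => s.2.1.isSome)
        (.push .scratch (fun s => s.2.1.getD false) <|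
          if p.1 = r ∧ q.1 = r then
            .pop .input (fun s x => (s.1, s.2.1, x)) <|
              .branch (fun s => s.2.2.isSome)
                (.push .output (fun s => s.2.2.getD false) <| .goto fun _ => .emit p q)
                (.goto fun _ => .emit p q)
          else .push .output (fun s => A p q && s.2.1.getD false) <| .goto fun _ => .emit p q)
        (.goto fun _ => .unemit p q)
  | .unemit p q =>
    .pop .scratch (fun s x => (s.1, x, none)) <|
      .branch (fun s => s.2.1.isSome)
        (.push .row (fun s => s.2.1.getD false) <| .goto fun _ => .unemit p q)
        (.goto fun _ => blocksLabel p q.1 q.2.le)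
  -- The output is a stack: the unary prefix opens the encoding and is therefore written last.
  | .separator => .push .output (fun _ => false) <| .goto fun _ => .finish
  | .finish =>
    .pop .row (fun s x => (s.1, x, none)) <|
      .branch (fun s => s.2.1.isSome) (pushTrue a <| .goto fun _ => .finish) .halt

/-- A configuration of the machine. -/
abbrev cfg (l : Option (Label a)) (v : State) (i x y o : List Bool) :
    TM2.Cfg (fun _ : Stack => Bool) (Label a) State :=
  ⟨l, v, stk i x y o⟩

/-- The computation relation of the machine. -/
abbrev Runs (n : ℕ) (c c' : TM2.Cfg (fun _ : Stack => Bool) (Label a) State) : Prop :=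
  ReachesWithin (TM2.step (program A r)) n c c'

/-! ### Runs of the attaching machine and their length -/

variable (i x y o : List Bool) (c : Bool)

theorem runs_parse (N : ℕ) (v : Option Bool × Option Bool) :
    Runs (a := a) A r (N + 1)
      (cfg (some .parse) (c, v) (List.replicate N true ++ false :: i) x [] [])
      (cfg (some (rowsLabel a le_rfl)) (c, none, none) i (List.replicate N false ++ x) [] []) := by
  induction N generalizing x v with
  | zero => exact .single (by simp [program])
  | succ N ih =>
    have h := ih (false :: x) (some true, none)
    rw [show List.replicate (N + 1) false ++ x = List.replicate N false ++ false :: x by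
      rw [List.replicate_succ', List.append_assoc]; rfl]
    exact .head (by simp [program, List.replicate_succ]) h

theorem runs_shift_aux (p : Fin a) (v : Option Bool × Option Bool) :
    Runs A r (x.length + 1) (cfg (some (.shift p)) (c, v) i x y o)
      (cfg (some (.unshift p)) ((c :: x).getLast (by simp), none, none) i []
        ((c :: x).dropLast.reverse ++ y) o) := by
  induction x generalizing y c v with
  | nil => exact .single (by simp [program])
  | cons b x ih =>
    have h := ih (c :: y) b (none, none)
    rw [show (c :: b :: x).dropLast.reverse ++ y = (b :: x).dropLast.reverse ++ c :: y by simp]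
    rw [List.getLast_cons (by simp)]
    exact .head (by simp [program]) h

theorem runs_unshift (p : Fin a) (v : Option Bool × Option Bool) :
    Runs A r (y.length + 1) (cfg (some (.unshift p)) (c, v) i x y o)
      (cfg (some (if c then rowsLabel p.1 p.2.le else blocksLabel p a le_rfl)) (c, none, none) i
        (y.reverse ++ x) [] o) := by
  induction y generalizing x v with
  | nil => cases c <;> exact .single (by simp [program])
  | cons b y ih =>
    have h := ih (b :: x) (some b, none)
    rw [show (b :: y).reverse ++ x = y.reverse ++ b :: x by simp]
    exact .head (by simp [program]) h

theorem runs_shift (p : Fin a) :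
    Runs A r (2 * (x.length + 1)) (cfg (some (.shift p)) (c, none, none) i x [] o)
      (cfg (some (if (c :: x).getLast (by simp) then rowsLabel p.1 p.2.le
          else blocksLabel p a le_rfl)) ((c :: x).getLast (by simp), none, none) i
        (c :: x).dropLast [] o) := by
  have h₁ := runs_shift_aux A r i x [] o c p (none, none)
  have h₂ := runs_unshift A r i [] ((c :: x).dropLast.reverse ++ []) o
    ((c :: x).getLast (by simp)) p (none, none)
  simp only [List.append_nil, List.reverse_reverse] at h₁ h₂
  exact (h₁.trans h₂).mono (by simp; omega)

/-- The effect of writing one block on the input and the output. -/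
def block (p q : ℕ) (x : List Bool) (s : List Bool × List Bool) : List Bool × List Bool :=
  if p = r ∧ q = r then (s.1.drop x.length, (s.1.take x.length).reverse ++ s.2)
  else (s.1, (x.map fun b => A p q && b).reverse ++ s.2)

theorem runs_emit (p q : Fin a) (v : Option Bool × Option Bool) :
    Runs A r (x.length + 1) (cfg (some (.emit p q)) (c, v) i x y o)
      (cfg (some (.unemit p q)) (c, none, none) (block A r p q x (i, o)).1 []
        (x.reverse ++ y) (block A r p q x (i, o)).2) := by
  by_cases hpq : p.1 = r ∧ q.1 = r
  · simp only [block, if_pos hpq]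
    induction x generalizing y i o v with
    | nil => exact .single (by simp [program, hpq])
    | cons b x ih =>
      rw [show (b :: x).reverse ++ y = x.reverse ++ b :: y by simp]
      cases i with
      | nil =>
        have h := ih [] (b :: y) o (some b, none)
        simp only [List.drop_nil, List.take_nil, List.reverse_nil, List.nil_append] at h ⊢
        exact .head (by simp [program, hpq]) h
      | cons d i =>
        rw [show (List.take (b :: x).length (d :: i)).reverse ++ o =
          (List.take x.length i).reverse ++ d :: o by simp]
        exact .head (by simp [program, hpq]) (ih i (b :: y) (d :: o) (some b, some d))
  · simp only [block, if_neg hpq]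
    induction x generalizing y o v with
    | nil => exact .single (by simp [program, hpq])
    | cons b x ih =>
      have h := ih (b :: y) ((A p q && b) :: o) (some b, none)
      rw [show (b :: x).reverse ++ y = x.reverse ++ b :: y by simp]
      rw [show (List.map (fun b => A p q && b) (b :: x)).reverse ++ o =
        (List.map (fun b => A p q && b) x).reverse ++ (A p q && b) :: o by simp]
      exact .head (by simp [program, hpq]) h

theorem runs_unemit (p q : Fin a) (v : Option Bool × Option Bool) :
    Runs A r (y.length + 1) (cfg (some (.unemit p q)) (c, v) i x y o)
      (cfg (some (blocksLabel p q.1 q.2.le)) (c, none, none) i (y.reverse ++ x) [] o) := by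
  induction y generalizing x v with
  | nil => exact .single (by simp [program])
  | cons b y ih =>
    have h := ih (b :: x) (some b, none)
    rw [show (b :: y).reverse ++ x = y.reverse ++ b :: x by simp]
    exact .head (by simp [program]) h

theorem runs_block (p q : Fin a) :
    Runs A r (2 * (x.length + 1)) (cfg (some (.emit p q)) (c, none, none) i x [] o)
      (cfg (some (blocksLabel p q.1 q.2.le)) (c, none, none) (block A r p q x (i, o)).1 x []
        (block A r p q x (i, o)).2) := by
  have h₁ := runs_emit A r i x [] o c p q (none, none)
  have h₂ := runs_unemit A r (block A r p q x (i, o)).1 [] (x.reverse ++ [])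
    (block A r p q x (i, o)).2 c p q (none, none)
  simp only [List.append_nil, List.reverse_reverse] at h₁ h₂
  exact (h₁.trans h₂).mono (by simp; omega)

/-- The effect of writing the blocks with number less than `k` of a row. -/
def blocks (p : ℕ) (x : List Bool) : ℕ → List Bool × List Bool → List Bool × List Bool
  | 0, s => s
  | k + 1, s => blocks p x k (block A r p k x s)

theorem runs_blocks (p : Fin a) (k : ℕ) (hk : k ≤ a) :
    Runs A r (k * (2 * (x.length + 1)))
      (cfg (some (blocksLabel p k hk)) (c, none, none) i x [] o)
      (cfg (some (.shift p)) (c, none, none) (blocks A r p x k (i, o)).1 x []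
        (blocks A r p x k (i, o)).2) := by
  induction k generalizing i o with
  | zero => exact (ReachesWithin.refl _ _).mono (by simp)
  | succ k ih =>
    exact ((runs_block A r i x o c p ⟨k, hk⟩).trans (ih _ _ (by omega))).mono
      (by rw [Nat.succ_mul k, Nat.add_comm])

/-- The unit vector of length `N` with `true` at position `j`. -/
def unitVec (N j : ℕ) : List Bool := (List.range N).map fun t => t == j

/-- The effect of writing `m` rows, from row `j` on. -/
def rows (N p j : ℕ) : ℕ → List Bool × List Bool → List Bool × List Bool
  | 0, s => s
  | m + 1, s => rows N p (j + 1) m (blocks A r p (unitVec N j) a s)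

theorem length_unitVec (N j : ℕ) : (unitVec N j).length = N := by simp [unitVec]

theorem unitVec_succ (N j : ℕ) : unitVec (N + 1) j = unitVec N j ++ [N == j] := by
  simp [unitVec, List.range_succ]

theorem unitVec_succ_succ (N j : ℕ) : unitVec (N + 1) (j + 1) = false :: unitVec N j := by
  simp [unitVec, List.range_succ_eq_map]

theorem unitVec_succ_zero (N : ℕ) : unitVec (N + 1) 0 = true :: List.replicate N false := by
  simp [unitVec, List.range_succ_eq_map, List.eq_replicate_iff]

theorem unitVec_self (N : ℕ) : unitVec N N = List.replicate N false := by
  simp [unitVec, List.eq_replicate_iff]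
  omega

/-- Carry and row together form a unit vector of length $N+1$, whose last entry each shift moves
into the carry. There is one shift more than there are rows: the last one detects the end and leaves
the zero vector with carry `true`, ready for the next gadget vertex. -/
theorem runs_rows (p : Fin a) (N j m : ℕ) (hj : j + m = N) (hx : c :: x = unitVec (N + 1) j) :
    Runs A r ((m + 1) * (2 * (N + 1)) + m * (a * (2 * (N + 1))))
      (cfg (some (.shift p)) (c, none, none) i x [] o)
      (cfg (some (rowsLabel p.1 p.2.le)) (true, none, none) (rows (a := a) A r N p j m (i, o)).1
        (List.replicate N false) [] (rows (a := a) A r N p j m (i, o)).2) := by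
  induction m generalizing j c x i o with
  | zero =>
    have h := runs_shift A r i x o c p
    have hl : x.length = N := by
      have := congrArg List.length hx
      rw [length_unitVec] at this
      simpa using this
    simp only [hx, unitVec_succ, List.getLast_append_singleton, List.dropLast_concat] at h
    obtain rfl : j = N := by omega
    simp only [beq_self_eq_true, if_true, unitVec_self, hl] at h
    exact h.mono (by omega)
  | succ m ih =>
    have h := runs_shift A r i x o c p
    have hl : x.length = N := by
      have := congrArg List.length hx
      rw [length_unitVec] at this
      simpa using this
    have hjN : (N == j) = false := by simp; omega
    simp only [hx, unitVec_succ, List.getLast_append_singleton, List.dropLast_concat, hjN, hl,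
      Bool.false_eq_true, if_false] at h
    have h₂ := runs_blocks A r i (unitVec N j) o false p a le_rfl
    rw [length_unitVec] at h₂
    have h₃ := ih (blocks A r p (unitVec N j) a (i, o)).1 (unitVec N j)
      (blocks A r p (unitVec N j) a (i, o)).2 false (j + 1) (by omega)
      (unitVec_succ_succ N j).symm
    exact ((h.trans h₂).trans h₃).mono (by
      rw [Nat.succ_mul (m + 1), Nat.succ_mul m (a * _)]; omega)

/-- The effect of writing the rows of the gadget vertices with number less than `k`. -/
def allRows (N : ℕ) : ℕ → List Bool × List Bool → List Bool × List Bool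
  | 0, s => s
  | k + 1, s => allRows N k (rows (a := a) A r N k 0 N s)

theorem runs_allRows (N k : ℕ) (hk : k ≤ a) :
    Runs A r (k * ((N + 1) * (2 * (N + 1)) + N * (a * (2 * (N + 1)))))
      (cfg (some (rowsLabel k hk)) (true, none, none) i (List.replicate N false) [] o)
      (cfg (some .separator) (true, none, none) (allRows (a := a) A r N k (i, o)).1
        (List.replicate N false) [] (allRows (a := a) A r N k (i, o)).2) := by
  induction k generalizing i o with
  | zero => exact (ReachesWithin.refl _ _).mono (by simp)
  | succ k ih =>
    exact ((runs_rows A r i (List.replicate N false) o true ⟨k, hk⟩ N 0 N (by omega)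
      (unitVec_succ_zero N).symm).trans (ih _ _ (by omega))).mono
      (by rw [Nat.succ_mul k, Nat.add_comm])

theorem runs_finish (v : Option Bool × Option Bool) :
    Runs (a := a) A r (x.length + 1) (cfg (some .finish) (c, v) [] x [] o)
      (cfg none (c, none, none) [] [] [] (List.replicate (a * x.length) true ++ o)) := by
  induction x generalizing o v with
  | nil => exact .single (by simp [program])
  | cons b x ih =>
    have h := ih (List.replicate a true ++ o) (some b, none)
    rw [show List.replicate (a * (b :: x).length) true ++ o =
        List.replicate (a * x.length) true ++ (List.replicate a true ++ o) by
      rw [← List.append_assoc, List.replicate_append_replicate, List.length_cons, Nat.mul_succ]]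
    exact .head (by simp [program, stepAux_pushTrue]) h

theorem runs_all (N : ℕ) (l : List Bool)
    (hl : allRows (a := a) A r N a (i, []) = ([], l)) :
    Runs (a := a) A r (2 * a * (a + 1) * (N + 1) ^ 2 + 2 * N + 3)
      (cfg (some .parse) (true, none, none) (List.replicate N true ++ false :: i) [] [] [])
      (cfg none (true, none, none) [] [] [] (List.replicate (a * N) true ++ false :: l)) := by
  have h₁ := runs_parse (a := a) A r i [] true N (none, none)
  have h₂ := runs_allRows (a := a) A r i [] N a le_rfl
  rw [hl] at h₂
  rw [List.append_nil] at h₁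
  have h₃ : Runs (a := a) A r 1
      (cfg (some .separator) (true, none, none) [] (List.replicate N false) [] l)
      (cfg (some .finish) (true, none, none) [] (List.replicate N false) [] (false :: l)) :=
    .single (by simp [program])
  have h₄ := runs_finish (a := a) A r (List.replicate N false) (false :: l) true (none, none)
  rw [List.length_replicate] at h₄
  refine (((h₁.trans h₂).trans h₃).trans h₄).mono ?_
  have : a * ((N + 1) * (2 * (N + 1)) + N * (a * (2 * (N + 1)))) ≤
      2 * a * (a + 1) * (N + 1) ^ 2 := by
    have : N * (a * (2 * (N + 1))) ≤ (N + 1) * (a * (2 * (N + 1))) :=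
      Nat.mul_le_mul_right _ (by omega)
    calc _ ≤ a * ((N + 1) * (2 * (N + 1)) + (N + 1) * (a * (2 * (N + 1)))) := by gcongr
      _ = _ := by ring
  omega

end AttachMachine

namespace SimpleGraph

/-- The graph that arises from `G` by attaching to each vertex `i` the graph `A i`, the vertex `i`
being identified with the vertex `r` of `A i`. -/
def attach {I P : Type*} (G : SimpleGraph I) (A : I → SimpleGraph P) (r : P) :
    SimpleGraph (I × P) where
  Adj x y := (x.2 = r ∧ y.2 = r ∧ G.Adj x.1 y.1) ∨ (x.1 = y.1 ∧ (A x.1).Adj x.2 y.2)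
  symm := ⟨by
    rintro x y (⟨hx, hy, h⟩ | ⟨h, h'⟩)
    · exact .inl ⟨hy, hx, h.symm⟩
    · exact .inr ⟨h.symm, h ▸ h'.symm⟩⟩
  loopless := ⟨by
    rintro x (⟨-, -, h⟩ | ⟨-, h⟩)
    · exact h.ne rfl
    · exact h.ne rfl⟩

theorem attach_adj {I P : Type*} {G : SimpleGraph I} {A : I → SimpleGraph P} {r : P}
    {x y : I × P} : (G.attach A r).Adj x y ↔
      (x.2 = r ∧ y.2 = r ∧ G.Adj x.1 y.1) ∨ (x.1 = y.1 ∧ (A x.1).Adj x.2 y.2) := Iff.rfl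

end SimpleGraph

/-! ### Numbering and adjacency strings of graphs with attached gadgets -/

/-- The numbering of the vertices of a graph with attached gadgets. -/
def attachEquiv (a N : ℕ) : Fin (a * N) ≃ Fin N × Fin a :=
  -- The reversal accounts for the output stack: the rows and columns of $G$ come out in opposite
  -- order.
  finProdFinEquiv.symm.trans ((Equiv.prodComm _ _).trans (Equiv.prodCongr Fin.revPerm (.refl _)))

/-- The finite graph that arises by attaching a copy of `A` to each vertex. -/
def attachFin {a : ℕ} (A : SimpleGraph (Fin a)) (r : Fin a) (G : FinGraph) : FinGraph :=
  ⟨a * G.1, (G.2.attach (fun _ => A) r).comap (attachEquiv a G.1)⟩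

theorem adjBits_eq {N : ℕ} (G : SimpleGraph (Fin N)) (b : ℕ → ℕ → Bool)
    (hb : ∀ i j : Fin N, b i j = true ↔ G.Adj i j) :
    adjBits G = (List.range N).flatMap fun i => (List.range N).map (b i) := by
  classical
  rw [← List.map_coe_finRange_eq_range, List.flatMap_map, adjBits]
  refine congrArg (List.flatMap · _) (funext fun i => ?_)
  rw [List.map_map]
  refine List.map_congr_left fun j _ => ?_
  rw [Bool.eq_iff_iff]
  simp [hb]

theorem range_mul (a N : ℕ) :
    List.range (a * N) = (List.range a).flatMap fun p => (List.range N).map (p * N + ·) := by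
  induction a with
  | zero => simp
  | succ a ih => rw [Nat.succ_mul, List.range_add, ih, List.range_succ]; simp

theorem flatMap_range_congr {β : Type*} {n : ℕ} {f g : ℕ → List β}
    (h : ∀ i < n, f i = g i) : (List.range n).flatMap f = (List.range n).flatMap g := by
  rw [List.flatMap, List.flatMap]
  congr 1
  exact List.map_congr_left fun i hi => h i (List.mem_range.1 hi)

theorem reverse_range_map {β : Type*} (N : ℕ) (f : ℕ → β) :
    ((List.range N).map f).reverse = (List.range N).map fun t => f (N - 1 - t) := by
  rw [← List.map_reverse, List.range_eq_range', List.reverse_range', List.map_map,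
    ← List.range_eq_range']
  refine List.map_congr_left fun t _ => ?_
  simp

/-! ### Closed form of the output -/

namespace AttachMachine

variable {a : ℕ} (A : ℕ → ℕ → Bool) (r : ℕ) (g : ℕ → ℕ → Bool) (N : ℕ)

/-- The entries of the adjacency matrix of the graph with attached gadgets. -/
def bit (p i q t : ℕ) : Bool :=
  if p = r ∧ q = r then g (N - 1 - i) (N - 1 - t) else A p q && i == t

/-- The input before the block is described through what is left after it: a row of `g` precedes
`rest` exactly if this block consumes one. In this form the statements chain by induction without
tracking positions in the input. -/
theorem block_eq (p q j : ℕ) (hj : j < N) (rest o : List Bool) :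
    block A r p q (unitVec N j)
      (if p = r ∧ q = r then (List.range N).map (g j) ++ rest else rest, o) =
      (rest, (List.range N).map (bit A r g N p (N - 1 - j) q) ++ o) := by
  unfold block bit
  split_ifs with h
  · rw [length_unitVec]
    rw [List.drop_left' (by simp), List.take_left' (by simp), reverse_range_map]
    congr 2
    rw [show N - 1 - (N - 1 - j) = j by omega]
  · rw [unitVec, List.map_map, reverse_range_map]
    congr 2
    refine List.map_congr_left fun t ht => ?_
    rw [List.mem_range] at ht
    rw [Bool.eq_iff_iff]
    simp only [Function.comp_apply, Bool.and_eq_true, beq_iff_eq]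
    refine and_congr_right fun _ => ?_
    omega

theorem blocks_eq (p j : ℕ) (hj : j < N) (k : ℕ) (rest o : List Bool) :
    blocks A r p (unitVec N j) k
      (if p = r ∧ r < k then (List.range N).map (g j) ++ rest else rest, o) =
      (rest, ((List.range k).flatMap fun q =>
        (List.range N).map (bit A r g N p (N - 1 - j) q)) ++ o) := by
  induction k generalizing o with
  | zero => simp [blocks]
  | succ k ih =>
    rw [blocks]
    have h := block_eq A r g N p k j hj
      (if p = r ∧ r < k then (List.range N).map (g j) ++ rest else rest) o
    have e : (if p = r ∧ k = r then (List.range N).map (g j) ++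
        (if p = r ∧ r < k then (List.range N).map (g j) ++ rest else rest) else
        (if p = r ∧ r < k then (List.range N).map (g j) ++ rest else rest)) =
        if p = r ∧ r < k + 1 then (List.range N).map (g j) ++ rest else rest := by
      by_cases h1 : p = r
      · rcases lt_trichotomy r k with h2 | h2 | h2
        · rw [if_neg (by omega), if_pos ⟨h1, h2⟩, if_pos (by omega)]
        · rw [if_pos (by omega), if_neg (by omega), if_pos (by omega)]
        · rw [if_neg (by omega), if_neg (by omega), if_neg (by omega)]
      · simp [h1]
    rw [e] at h
    rw [h, ih, List.range_succ]
    simp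

/-- Rows written later lie higher on the output stack, whence the reversed range. -/
theorem rows_eq (hr : r < a) (p j m : ℕ) (hj : j + m = N) (rest o : List Bool) :
    rows (a := a) A r N p j m
      (if p = r then ((List.range' j m).flatMap fun j => (List.range N).map (g j)) ++ rest
        else rest, o) =
      (rest, ((List.range' j m).reverse.flatMap fun j => (List.range a).flatMap fun q =>
        (List.range N).map (bit A r g N p (N - 1 - j) q)) ++ o) := by
  induction m generalizing j o with
  | zero => simp [rows]
  | succ m ih =>
    rw [rows]
    have h := blocks_eq A r g N p j (by omega) a
      (if p = r then ((List.range' (j + 1) m).flatMap fun j => (List.range N).map (g j)) ++ rest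
        else rest) o
    have e : (if p = r ∧ r < a then (List.range N).map (g j) ++
        (if p = r then ((List.range' (j + 1) m).flatMap fun j => (List.range N).map (g j)) ++ rest
        else rest) else
        (if p = r then ((List.range' (j + 1) m).flatMap fun j => (List.range N).map (g j)) ++ rest
        else rest)) =
        if p = r then ((List.range' j (m + 1)).flatMap fun j => (List.range N).map (g j)) ++ rest
        else rest := by
      by_cases h1 : p = r
      · simp [h1, hr, List.range'_succ]
      · simp [h1]
    rw [e] at h
    rw [h, ih (j + 1) (by omega), List.range'_succ]
    simp

theorem allRows_eq (hr : r < a) (k : ℕ) (o : List Bool) :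
    allRows (a := a) A r N k
      (if r < k then ((List.range N).flatMap fun j => (List.range N).map (g j)) else [], o) =
      ([], ((List.range k).flatMap fun p => (List.range N).flatMap fun i =>
        (List.range a).flatMap fun q => (List.range N).map (bit A r g N p i q)) ++ o) := by
  induction k generalizing o with
  | zero => simp [allRows]
  | succ k ih =>
    rw [allRows]
    have h := rows_eq A r g N hr k 0 N (by omega)
      (if r < k then ((List.range N).flatMap fun j => (List.range N).map (g j)) else []) o
    have e : (if k = r then ((List.range' 0 N).flatMap fun j => (List.range N).map (g j)) ++
        (if r < k then ((List.range N).flatMap fun j => (List.range N).map (g j)) else []) else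
        (if r < k then ((List.range N).flatMap fun j => (List.range N).map (g j)) else [])) =
        if r < k + 1 then ((List.range N).flatMap fun j => (List.range N).map (g j)) else [] := by
      rcases lt_trichotomy r k with h2 | h2 | h2
      · rw [if_neg (by omega), if_pos h2, if_pos (by omega)]
      · rw [if_pos (by omega), if_neg (by omega), if_pos (by omega), List.range_eq_range']
        simp
      · rw [if_neg (by omega), if_neg (by omega), if_neg (by omega)]
    rw [e] at h
    rw [h, ih, List.range_succ, List.flatMap_append, List.append_assoc, List.flatMap_singleton]
    congr 3
    rw [List.reverse_range', List.flatMap_map]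
    refine flatMap_range_congr fun i hi => ?_
    rw [show N - 1 - (0 + N - 1 - i) = i by omega]

theorem range_flatMap_bit_eq (hN : 0 < N) :
    ((List.range (a * N)).flatMap fun v => (List.range (a * N)).map fun w =>
      bit A r g N (v / N) (v % N) (w / N) (w % N)) =
    (List.range a).flatMap fun p => (List.range N).flatMap fun i =>
      (List.range a).flatMap fun q => (List.range N).map (bit A r g N p i q) := by
  have hd : ∀ p i, i < N → (p * N + i) / N = p ∧ (p * N + i) % N = i := by
    intro p i hi
    constructor
    · rw [Nat.mul_comm, Nat.mul_add_div hN, Nat.div_eq_of_lt hi, Nat.add_zero]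
    · rw [Nat.mul_comm, Nat.mul_add_mod, Nat.mod_eq_of_lt hi]
  rw [range_mul, List.flatMap_assoc]
  refine flatMap_range_congr fun p _ => ?_
  rw [List.flatMap_map]
  refine flatMap_range_congr fun i hi => ?_
  rw [List.map_flatMap]
  refine flatMap_range_congr fun q _ => ?_
  rw [List.map_map]
  refine List.map_congr_left fun t ht => ?_
  rw [List.mem_range] at ht
  simp only [Function.comp_apply, hd p i hi, hd q t ht]

end AttachMachine

open Classical in
/-- The adjacency matrix of a graph on `Fin N`, as a function on pairs of natural numbers. -/
noncomputable def SimpleGraph.natAdj {N : ℕ} (G : SimpleGraph (Fin N)) (i j : ℕ) : Bool :=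
  if h : i < N ∧ j < N then decide (G.Adj ⟨i, h.1⟩ ⟨j, h.2⟩) else false

theorem SimpleGraph.natAdj_eq_true {N : ℕ} (G : SimpleGraph (Fin N)) (i j : Fin N) :
    G.natAdj i j = true ↔ G.Adj i j := by
  simp [natAdj]

theorem adjBits_attachFin {a : ℕ} (A : SimpleGraph (Fin a)) (r : Fin a) (G : FinGraph) :
    AttachMachine.allRows (a := a) A.natAdj r G.1 a (adjBits G.2, []) =
      ([], adjBits (attachFin A r G).2) := by
  obtain ⟨N, G⟩ := G
  have h := AttachMachine.allRows_eq (a := a) A.natAdj r G.natAdj N r.2 a []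
  rw [if_pos r.2, ← adjBits_eq G G.natAdj G.natAdj_eq_true, List.append_nil] at h
  rw [h]
  congr 1
  rcases Nat.eq_zero_or_pos N with rfl | hN
  · rw [adjBits_eq (attachFin A r ⟨0, G⟩).2 _ (attachFin A r ⟨0, G⟩).2.natAdj_eq_true]
    simp [attachFin]
  · rw [← AttachMachine.range_flatMap_bit_eq _ _ _ _ hN]
    refine (adjBits_eq (attachFin A r ⟨N, G⟩).2 (fun v w => AttachMachine.bit A.natAdj r
      G.natAdj N (v / N) (v % N) (w / N) (w % N)) fun v w => ?_).symm
    have key : ∀ p q : Fin a, ∀ i j : Fin N,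
        AttachMachine.bit A.natAdj r G.natAdj N p i q j = true ↔
          (G.attach (fun _ => A) r).Adj (i.rev, p) (j.rev, q) := by
      intro p q i j
      rw [SimpleGraph.attach_adj, AttachMachine.bit]
      have e : ∀ i : Fin N, N - 1 - (i : ℕ) = (i.rev : ℕ) := fun i => by
        rw [Fin.val_rev]; omega
      split_ifs with hpq
      · obtain ⟨h1, h2⟩ := hpq
        obtain rfl := Fin.ext h1
        obtain rfl := Fin.ext h2
        rw [e, e, SimpleGraph.natAdj_eq_true]
        simp
      · have h3 : ¬ (p = r ∧ q = r ∧ G.Adj i.rev j.rev) := fun ⟨h1, h2, _⟩ =>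
          hpq ⟨congrArg Fin.val h1, congrArg Fin.val h2⟩
        simp only [h3, false_or, Fin.rev_inj, Bool.and_eq_true, SimpleGraph.natAdj_eq_true,
          beq_iff_eq, Fin.val_inj]
        exact and_comm
    exact key (Fin.divNat (m := a) (n := N) v) (Fin.divNat (m := a) (n := N) w)
      (Fin.modNat (m := a) (n := N) v) (Fin.modNat (m := a) (n := N) w)

namespace AttachMachine

/-- The machine that attaches copies of a gadget to the vertices of a graph. -/
def machine (a : ℕ) (A : ℕ → ℕ → Bool) (r : ℕ) : FinTM2 where
  K := Stack
  k₀ := .input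
  k₁ := .output
  Γ := fun _ => Bool
  Λ := Label a
  main := .parse
  σ := State
  initialState := (true, none, none)
  Γk₀Fin := inferInstanceAs (Fintype Bool)
  m := program A r

end AttachMachine

/-- Attaching copies of a fixed gadget to the vertices of a graph takes polynomial time. -/
theorem nonempty_computableInPolyTime_attachFin {a : ℕ} (A : SimpleGraph (Fin a)) (r : Fin a) :
    Nonempty (TM2ComputableInPolyTime encodeGraph encodeGraph (attachFin A r)) := by
  have key : ∀ G : FinGraph, Nonempty (TM2OutputsInTime (AttachMachine.machine a A.natAdj r)
      ((encodeGraph G).map (Equiv.refl Bool).invFun)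
      (some ((encodeGraph (attachFin A r G)).map (Equiv.refl Bool).invFun))
      ((Polynomial.C (2 * a * (a + 1)) * (Polynomial.X + 1) ^ 2 + 2 * Polynomial.X + 3).eval
        (encodeGraph G).length)) := by
    intro G
    have hN : G.1 ≤ (encodeGraph G).length := by simp [encodeGraph]
    obtain ⟨n, hn, h⟩ := AttachMachine.runs_all (a := a) A.natAdj r (adjBits G.2) G.1 _
      (adjBits_attachFin A r G)
    have h₁ : initList (AttachMachine.machine a A.natAdj r)
        ((encodeGraph G).map (Equiv.refl Bool).invFun) = AttachMachine.cfg
          (some .parse) (true, none, none) (encodeGraph G) [] [] [] := by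
      refine (initList_eq (AttachMachine.machine a A.natAdj r) _).trans ?_
      refine congrArg (TM2.Cfg.mk _ _) ?_
      funext k
      cases k <;> simp [AttachMachine.machine, AttachMachine.stk, Function.update]
    have h₂ : haltList (AttachMachine.machine a A.natAdj r)
        ((encodeGraph (attachFin A r G)).map (Equiv.refl Bool).invFun) = AttachMachine.cfg
          none (true, none, none) [] [] [] (encodeGraph (attachFin A r G)) := by
      refine (haltList_eq (AttachMachine.machine a A.natAdj r) _).trans ?_
      refine congrArg (TM2.Cfg.mk _ _) ?_
      funext k
      cases k <;> simp [AttachMachine.machine, AttachMachine.stk, Function.update]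
    have h₃ : ReachesIn (AttachMachine.machine a A.natAdj r).step n
        (initList (AttachMachine.machine a A.natAdj r)
          ((encodeGraph G).map (Equiv.refl Bool).invFun))
        (haltList (AttachMachine.machine a A.natAdj r)
          ((encodeGraph (attachFin A r G)).map (Equiv.refl Bool).invFun)) := by
      rw [h₁, h₂]
      exact h
    refine h₃.evalsToInTime (hn.trans ?_)
    simp only [Polynomial.eval_add, Polynomial.eval_mul, Polynomial.eval_pow, Polynomial.eval_X,
      Polynomial.eval_C, Polynomial.eval_ofNat, Polynomial.eval_one]
    gcongr
  exact ⟨{ tm := AttachMachine.machine a A.natAdj r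
           inputAlphabet := .refl Bool
           outputAlphabet := .refl Bool
           time := _
           outputsFun := fun G => (key G).some }⟩

/-! ### Good colorings, and graphs with attached gadgets -/

namespace SimpleGraph

variable {V V' U W I P : Type*}

theorem image_neighborSet_comap_subset (φ : V' → V) (R : SimpleGraph V)
    (x : V') : φ '' (R.comap φ).neighborSet x ⊆ R.neighborSet (φ x) := by
  rintro _ ⟨y, hy, rfl⟩
  exact hy

theorem ncard_neighborSet_comap_le [Finite V] {φ : V' → V} (hφ : Function.Injective φ)
    (R : SimpleGraph V) (x : V') :
    ((R.comap φ).neighborSet x).ncard ≤ (R.neighborSet (φ x)).ncard := by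
  rw [← Set.ncard_image_of_injective _ hφ]
  exact Set.ncard_le_ncard (image_neighborSet_comap_subset φ R x) (Set.toFinite _)

/-- Two parts that meet only in `z` have disjoint neighborhoods there, so their red degrees add up.
All saturation arguments rest on this. -/
theorem ncard_neighborSet_comap_add_le [Finite V] {φ : V' → V} {ψ : U → V}
    (hφ : Function.Injective φ) (hψ : Function.Injective ψ) (R : SimpleGraph V) {x : V'} {y : U}
    {z : V} (hx : φ x = z) (hy : ψ y = z) (hd : ∀ p q, p ≠ x → q ≠ y → φ p ≠ ψ q) :
    ((R.comap φ).neighborSet x).ncard + ((R.comap ψ).neighborSet y).ncard ≤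
      (R.neighborSet z).ncard := by
  have h1 := image_neighborSet_comap_subset φ R x
  have h2 := image_neighborSet_comap_subset ψ R y
  rw [hx] at h1
  rw [hy] at h2
  rw [← Set.ncard_image_of_injective _ hφ, ← Set.ncard_image_of_injective _ hψ,
    ← Set.ncard_union_eq ?_ ((Set.toFinite _).subset h1) ((Set.toFinite _).subset h2)]
  · exact Set.ncard_le_ncard (Set.union_subset h1 h2) (Set.toFinite _)
  · rw [Set.disjoint_left]
    rintro _ ⟨p, hp, rfl⟩ ⟨q, hq, h⟩
    exact hd p q ((R.comap φ).ne_of_adj hp).symm ((R.comap ψ).ne_of_adj hq).symm h.symm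

/-! #### Good colorings -/

/-- `R` is the red graph of a coloring of `G` without red `K_{1,n}` and blue `H`. -/
structure IsGoodRed (n : ℕ) (H : SimpleGraph W) (G R : SimpleGraph V) : Prop where
  le : R ≤ G
  degree_lt : ∀ v, (R.neighborSet v).ncard < n
  free : H.Free (G \ R)

theorem starK_isContained_iff [Finite V] {n : ℕ} {R : SimpleGraph V} :
    (starK n).IsContained R ↔ ∃ v, n ≤ (R.neighborSet v).ncard := by
  constructor
  · rintro ⟨f⟩
    refine ⟨f (.inl 0), ?_⟩
    have hinj : Function.Injective fun i : Fin n => f (.inr i) :=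
      fun i j h => Sum.inr_injective (f.injective h)
    calc n = (Set.range fun i : Fin n => f (.inr i)).ncard := by
          rw [← Set.image_univ, Set.ncard_image_of_injective _ hinj, Set.ncard_univ]; simp
      _ ≤ _ := Set.ncard_le_ncard (by
          rintro _ ⟨i, rfl⟩
          exact f.toHom.map_adj (by simp)) (Set.toFinite _)
  · rintro ⟨v, hv⟩
    have : Fintype (R.neighborSet v) := Fintype.ofFinite _
    rw [← Nat.card_coe_set_eq, Nat.card_eq_fintype_card] at hv
    obtain ⟨g⟩ := Function.Embedding.nonempty_of_card_le (α := Fin n) (β := R.neighborSet v)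
      (by rwa [Fintype.card_fin])
    refine ⟨⟨⟨Sum.elim (fun _ => v) fun i => (g i : V), ?_⟩, ?_⟩⟩
    · rintro (i | i) (j | j) h
      · simp at h
      · exact (g j).2
      · exact (g i).2.symm
      · simp at h
    · rintro (i | i) (j | j) h
      · rw [Subsingleton.elim i j]
      · exact absurd h (g j).2.ne
      · exact absurd h.symm (g i).2.ne
      · exact congrArg _ (g.injective (Subtype.ext h))

/-- The red graph determines the coloring, so from here on colorings are subgraphs, restricted by
`comap`. -/
theorem arrows_starK_iff [Finite V] {n : ℕ} {H : SimpleGraph W} {G : SimpleGraph V} :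
    G.Arrows (starK n) H ↔ ∀ R, ¬ IsGoodRed n H G R := by
  classical
  constructor
  · intro h R hR
    let c : G.EdgeLabeling EdgeColor := fun e => if e.1 ∈ R.edgeSet then .red else .blue
    have hred : c.labelGraph .red = R := by
      ext x y
      rw [EdgeLabeling.labelGraph_adj]
      constructor
      · rintro ⟨_, h⟩
        by_contra hxy
        simp [c, hxy] at h
      · intro hxy
        exact ⟨hR.le hxy, by simp [c, hxy]⟩
    have hblue : c.labelGraph .blue = G \ R := by
      ext x y
      rw [EdgeLabeling.labelGraph_adj, sdiff_adj]
      constructor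
      · rintro ⟨hG, h⟩
        refine ⟨hG, fun hxy => ?_⟩
        simp [c, hxy] at h
      · rintro ⟨hG, hxy⟩
        exact ⟨hG, by simp [c, hxy]⟩
    rcases h c with h | h
    · rw [hred, starK_isContained_iff] at h
      obtain ⟨v, hv⟩ := h
      exact hv.not_gt (hR.degree_lt v)
    · rw [hblue] at h
      exact hR.free h
  · intro h c
    by_contra hc
    rw [not_or, starK_isContained_iff, not_exists] at hc
    refine h (c.labelGraph .red) ⟨c.labelGraph_le, fun v => not_le.1 (hc.1 v), fun hH => ?_⟩
    refine hc.2 (hH.mono_right fun x y hxy => ?_)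
    rw [EdgeLabeling.labelGraph_adj]
    rw [sdiff_adj, EdgeLabeling.labelGraph_adj] at hxy
    refine ⟨hxy.1, ?_⟩
    cases hcol : c ⟨s(x, y), hxy.1⟩ with
    | red => exact absurd ⟨hxy.1, hcol⟩ hxy.2
    | blue => rfl

theorem IsGoodRed.comap [Finite V] {n : ℕ} {H : SimpleGraph W} {G R : SimpleGraph V}
    (h : IsGoodRed n H G R) {φ : V' → V} (hφ : Function.Injective φ) :
    IsGoodRed n H (G.comap φ) (R.comap φ) where
  le _ _ hxy := h.le hxy
  degree_lt v := (ncard_neighborSet_comap_le hφ R v).trans_lt (h.degree_lt _)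
  free := fun ⟨f⟩ => h.free
    ⟨⟨⟨fun w => φ (f w), fun hab => f.toHom.map_adj hab⟩, hφ.comp f.injective⟩⟩

theorem arrows_comap_equiv [Finite V] [Finite V'] {n : ℕ} {H : SimpleGraph W}
    {G : SimpleGraph V} (e : V' ≃ V) :
    (G.comap e).Arrows (starK n) H ↔ G.Arrows (starK n) H := by
  rw [arrows_starK_iff, arrows_starK_iff]
  constructor
  · exact fun h R hR => h _ (hR.comap e.injective)
  · intro h R hR
    have := hR.comap e.symm.injective
    rw [comap_comap] at this
    exact h _ (by simpa using this)

/-! #### Attaching gadgets to the vertices of a graph -/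

theorem attach_comap_fiber {G : SimpleGraph I} {A : I → SimpleGraph P} {r : P} (i : I) :
    (G.attach A r).comap (fun p => (i, p)) = A i := by
  ext p q
  simp [attach_adj]

theorem attach_comap_root {G : SimpleGraph I} {A : I → SimpleGraph P} {r : P} :
    (G.attach A r).comap (fun i => (i, r)) = G := by
  ext i j
  simp [attach_adj]

theorem mk_left_injective (i : I) : Function.Injective fun p : P => (i, p) :=
  fun _ _ h => congrArg Prod.snd h

theorem mk_right_injective (r : P) : Function.Injective fun i : I => (i, r) :=
  fun _ _ h => congrArg Prod.fst h

theorem ncard_root_add_ncard_fiber_le [Finite I] [Finite P] (R : SimpleGraph (I × P)) (i : I)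
    (r : P) :
    ((R.comap fun i => (i, r)).neighborSet i).ncard +
      ((R.comap fun p => (i, p)).neighborSet r).ncard ≤ (R.neighborSet (i, r)).ncard := by
  refine ncard_neighborSet_comap_add_le (mk_right_injective r) (mk_left_injective i) R rfl rfl ?_
  intro j q hj _ h
  exact hj (congrArg Prod.fst h)

theorem neighborSet_attach_root {G : SimpleGraph I} {A : I → SimpleGraph P} {r : P} (i : I) :
    (G.attach A r).neighborSet (i, r) =
      (fun j => (j, r)) '' G.neighborSet i ∪ (fun p => (i, p)) '' (A i).neighborSet r := by
  ext ⟨j, q⟩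
  simp only [mem_neighborSet, attach_adj, Set.mem_union, Set.mem_image, Prod.mk.injEq]
  constructor
  · rintro (⟨-, rfl, h⟩ | ⟨rfl, h⟩)
    · exact .inl ⟨j, h, rfl, rfl⟩
    · exact .inr ⟨q, h, rfl, rfl⟩
  · rintro (⟨j, h, rfl, rfl⟩ | ⟨q, h, rfl, rfl⟩)
    · exact .inl ⟨trivial, rfl, h⟩
    · exact .inr ⟨rfl, h⟩

theorem neighborSet_attach_of_ne {G : SimpleGraph I} {A : I → SimpleGraph P} {r : P} (i : I)
    {p : P} (hp : p ≠ r) :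
    (G.attach A r).neighborSet (i, p) = (fun p => (i, p)) '' (A i).neighborSet p := by
  ext ⟨j, q⟩
  simp only [mem_neighborSet, attach_adj, Set.mem_image, Prod.mk.injEq]
  constructor
  · rintro (⟨h, -⟩ | ⟨rfl, h⟩)
    · exact absurd h hp
    · exact ⟨q, h, rfl, rfl⟩
  · rintro ⟨q, h, rfl, rfl⟩
    exact .inr ⟨rfl, h⟩

theorem ncard_neighborSet_attach_root_le {G : SimpleGraph I} {A : I → SimpleGraph P} {r : P}
    (i : I) : ((G.attach A r).neighborSet (i, r)).ncard ≤
      (G.neighborSet i).ncard + ((A i).neighborSet r).ncard := by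
  rw [neighborSet_attach_root]
  refine (Set.ncard_union_le _ _).trans ?_
  rw [Set.ncard_image_of_injective _ (mk_right_injective r),
    Set.ncard_image_of_injective _ (mk_left_injective i)]

/-- Removing at most one vertex of a 2-connected graph does not separate it. -/
theorem IsKConnected.forall_or_forall_not [Fintype W] {H : SimpleGraph W}
    (hH : H.IsKConnected 2) {S : Set W} (hS : S.Subsingleton) (side : W → Prop)
    (h : ∀ a b, H.Adj a b → a ∉ S → b ∉ S → (side a ↔ side b)) :
    (∀ a ∉ S, side a) ∨ ∀ a ∉ S, ¬ side a := by
  classical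
  have hc := hH.2.2 S.toFinset (by
    have : S.toFinset.card ≤ 1 := Finset.card_le_one.2 fun a ha b hb =>
      hS (by simpa using ha) (by simpa using hb)
    omega)
  have key : ∀ a b : {v | v ∉ S.toFinset}, side a ↔ side b := by
    intro a b
    obtain ⟨p⟩ := hc.preconnected a b
    induction p with
    | nil => exact Iff.rfl
    | @cons x y _ hxy _ ih =>
      refine (h x y hxy ?_ ?_).trans ih
      · simpa using x.2
      · simpa using y.2
  by_cases hex : ∃ a ∉ S, side a
  · obtain ⟨a, ha, hs⟩ := hex
    exact .inl fun b hb => (key ⟨a, by simpa using ha⟩ ⟨b, by simpa using hb⟩).1 hs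
  · push Not at hex
    exact .inr hex

/-- A copy of $H$ with a vertex off the roots enters some fiber, and the root of that fiber is the
only vertex through which it could leave. Since $H$ has no cut vertex, the copy stays in the fiber;
otherwise it consists of roots and lies in $G$. -/
theorem free_attach [Fintype W] {H : SimpleGraph W} (hH : H.IsKConnected 2) {G : SimpleGraph I}
    {A : I → SimpleGraph P} {r : P} (hG : H.Free G) (hA : ∀ i, H.Free (A i)) :
    H.Free (G.attach A r) := by
  rintro ⟨f⟩
  by_cases hroot : ∀ w, (f w).2 = r
  · refine hG ⟨⟨⟨fun w => (f w).1, fun {a b} hab => ?_⟩, fun a b hab => ?_⟩⟩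
    · rcases f.toHom.map_adj hab with ⟨-, -, h⟩ | ⟨-, h⟩
      · exact h
      · exact absurd ((hroot a).trans (hroot b).symm) h.ne
    · exact f.injective (Prod.ext hab ((hroot a).trans (hroot b).symm))
  · push Not at hroot
    obtain ⟨w₀, hw₀⟩ := hroot
    have hall : ∀ w, (f w).1 = (f w₀).1 := by
      have hw₀' : w₀ ∉ {w | f w = ((f w₀).1, r)} := fun h => hw₀ (congrArg Prod.snd h)
      have hedge : ∀ a b, H.Adj a b → a ∉ {w | f w = ((f w₀).1, r)} →
          b ∉ {w | f w = ((f w₀).1, r)} → ((f a).1 = (f w₀).1 ↔ (f b).1 = (f w₀).1) := by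
        intro a b hab ha hb
        rcases f.toHom.map_adj hab with ⟨h1, h2, h⟩ | ⟨h, -⟩
        · exact ⟨fun h3 => (ha (show f a = ((f w₀).1, r) from Prod.ext h3 h1)).elim,
            fun h3 => (hb (show f b = ((f w₀).1, r) from Prod.ext h3 h2)).elim⟩
        · exact ⟨fun h3 => h.symm.trans h3, fun h3 => h.trans h3⟩
      rcases hH.forall_or_forall_not (S := {w | f w = ((f w₀).1, r)})
        (fun a ha b hb => f.injective (Eq.trans ha (Eq.symm hb)))
        (fun w => (f w).1 = (f w₀).1) hedge with h | h
      · intro w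
        by_cases hw : w ∈ {w | f w = ((f w₀).1, r)}
        · have h2 : f w = ((f w₀).1, r) := hw
          rw [h2]
        · exact h w hw
      · exact absurd rfl (h w₀ hw₀')
    refine hA (f w₀).1 ⟨⟨⟨fun w => (f w).2, fun {a b} hab => ?_⟩, fun a b hab => ?_⟩⟩
    · rcases f.toHom.map_adj hab with ⟨-, -, h⟩ | ⟨-, h⟩
      · exact absurd ((hall a).trans (hall b).symm) h.ne
      · exact hall a ▸ h
    · exact f.injective (Prod.ext ((hall a).trans (hall b).symm) hab)

theorem IsGoodRed.attach [Fintype W] {H : SimpleGraph W} (hH : H.IsKConnected 2) {n : ℕ}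
    {G R : SimpleGraph I} {A S : I → SimpleGraph P} {r : P} (hle : R ≤ G) (hfree : H.Free (G \ R))
    (hS : ∀ i, IsGoodRed n H (A i) (S i))
    (hdeg : ∀ i, (R.neighborSet i).ncard + ((S i).neighborSet r).ncard < n) :
    IsGoodRed n H (G.attach A r) (R.attach S r) where
  le := by
    rintro x y (⟨hx, hy, h⟩ | ⟨h, h'⟩)
    · exact .inl ⟨hx, hy, hle h⟩
    · exact .inr ⟨h, (hS _).le h'⟩
  degree_lt := by
    rintro ⟨i, p⟩
    by_cases hp : p = r
    · subst hp
      exact (ncard_neighborSet_attach_root_le i).trans_lt (hdeg i)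
    · rw [neighborSet_attach_of_ne i hp, Set.ncard_image_of_injective _ (mk_left_injective i)]
      exact (hS i).degree_lt p
  free := by
    refine fun h => free_attach (r := r) hH hfree (fun i => (hS i).free) (h.mono_right ?_)
    rintro x y ⟨h | h, h'⟩
    · exact .inl ⟨h.1, h.2.1, h.2.2, fun h3 => h' (.inl ⟨h.1, h.2.1, h3⟩)⟩
    · exact .inr ⟨h.1, h.2, fun h3 => h' (.inr ⟨h.1, h3⟩)⟩

/-! #### Gadgets -/

/-- In a good coloring of `A` the vertex `r` has at least `m` red edges, and exactly `m` of them
for some good coloring. -/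
structure IsGadget (n : ℕ) (H : SimpleGraph W) (A : SimpleGraph P) (r : P) (m : ℕ) : Prop where
  le_degree : ∀ R, IsGoodRed n H A R → m ≤ (R.neighborSet r).ncard
  exists_degree_eq : ∃ R, IsGoodRed n H A R ∧ (R.neighborSet r).ncard = m

/-- Take for `m` the least red degree of `r` over all good colorings; being attained, it is below
`n`. -/
theorem exists_isGadget_of_pos {n : ℕ} {H : SimpleGraph W} {A R₀ : SimpleGraph P} {r : P}
    (h₀ : IsGoodRed n H A R₀) (h : ∀ R, IsGoodRed n H A R → 1 ≤ (R.neighborSet r).ncard) :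
    ∃ m, 1 ≤ m ∧ m < n ∧ IsGadget n H A r m := by
  classical
  have hex : ∃ m, ∃ R, IsGoodRed n H A R ∧ (R.neighborSet r).ncard = m := ⟨_, R₀, h₀, rfl⟩
  obtain ⟨R, hR, hm⟩ := Nat.find_spec hex
  refine ⟨Nat.find hex, hm ▸ h R hR, hm ▸ hR.degree_lt r, fun S hS => ?_, R, hR, hm⟩
  exact Nat.find_min' hex ⟨S, hS, rfl⟩

theorem IsGadget.comap_equiv [Finite P] [Finite V] {n m : ℕ} {H : SimpleGraph W}
    {A : SimpleGraph P} {r : P} (h : IsGadget n H A r m) (e : V ≃ P) :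
    IsGadget n H (A.comap e) (e.symm r) m := by
  have hdeg : ∀ R : SimpleGraph P,
      ((R.comap e).neighborSet (e.symm r)).ncard = (R.neighborSet r).ncard := by
    intro R
    refine le_antisymm ?_ ?_
    · simpa using ncard_neighborSet_comap_le e.injective R (e.symm r)
    · have := ncard_neighborSet_comap_le e.symm.injective (R.comap e) r
      rw [comap_comap] at this
      simpa using this
  constructor
  · intro R hR
    have h1 := hR.comap e.symm.injective
    rw [comap_comap] at h1
    have h2 := h.le_degree _ (by simpa using h1)
    exact h2.trans (ncard_neighborSet_comap_le e.symm.injective R r)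
  · obtain ⟨R, hR, hm⟩ := h.exists_degree_eq
    exact ⟨R.comap e, hR.comap e.injective, (hdeg R).trans hm⟩

/-- A gadget uses up at least `m` red edges at its root, which leaves fewer than `n - m` for `G`;
coloring every gadget with exactly `m` leaves just that room. -/
theorem IsGadget.arrows_attach_iff [Fintype W] [Finite I] [Finite P] {H : SimpleGraph W}
    (hH : H.IsKConnected 2) {n m : ℕ} {A : SimpleGraph P} {r : P} (h : IsGadget n H A r m)
    (G : SimpleGraph I) :
    (G.attach (fun _ => A) r).Arrows (starK n) H ↔ G.Arrows (starK (n - m)) H := by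
  rw [arrows_starK_iff, arrows_starK_iff, ← not_exists, ← not_exists, not_iff_not]
  constructor
  · rintro ⟨R, hR⟩
    have hroot := hR.comap (mk_right_injective r)
    rw [attach_comap_root] at hroot
    refine ⟨_, hroot.le, fun i => ?_, hroot.free⟩
    have hfiber := hR.comap (mk_left_injective i)
    rw [attach_comap_fiber] at hfiber
    have h1 := h.le_degree _ hfiber
    have h2 := ncard_root_add_ncard_fiber_le R i r
    have h3 := hR.degree_lt (i, r)
    omega
  · rintro ⟨R, hR⟩
    obtain ⟨S, hS, hm⟩ := h.exists_degree_eq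
    refine ⟨_, IsGoodRed.attach (r := r) hH hR.le hR.free (fun _ => hS) fun i => ?_⟩
    have := hR.degree_lt i
    omega

end SimpleGraph

/-! ### Rings of copies of a graph with two terminals -/

namespace SimpleGraph

variable {V W P : Type*}

section Ring

variable {l : ℕ} [DecidableEq P] (u v : P)

/-- The embedding of the `i`-th copy of a graph into a ring of copies, in which the vertex `v` of
each copy is identified with the vertex `u` of the next one. -/
def ringMap (i : Fin (l + 3)) (x : P) : Fin (l + 3) × P :=
  if x = v then (i + 1, u) else (i, x)

/-- A ring of `l + 3` copies of `B`, in which the vertex `v` of each copy is identified with the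
vertex `u` of the next one. -/
def ring (l : ℕ) (B : SimpleGraph P) : SimpleGraph (Fin (l + 3) × P) where
  -- For `u ≠ v` the pairs `(i, v)` belong to no copy and stay behind as isolated vertices.
  Adj a b := a ≠ b ∧ ∃ i x y, B.Adj x y ∧ ringMap u v i x = a ∧ ringMap u v i y = b
  symm := ⟨fun _ _ ⟨hne, i, x, y, h, hx, hy⟩ => ⟨hne.symm, i, y, x, h.symm, hy, hx⟩⟩
  loopless := ⟨fun _ h => h.1 rfl⟩

variable {u v}

/-- The reason for at least three copies: in a ring of two, both joints would be common to both
copies. -/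
theorem fin_add_one_add_one_ne (i : Fin (l + 3)) : i + 1 + 1 ≠ i := by
  intro h
  rw [add_assoc, add_eq_left] at h
  have h1 : (1 + 1 : Fin (l + 3)).val = 2 := by
    rw [Fin.val_add, Fin.val_one, Nat.mod_eq_of_lt (by omega)]
  rw [h] at h1
  exact absurd h1 (by simp)

theorem fin_add_one_ne (i : Fin (l + 3)) : i + 1 ≠ i := by
  intro h
  rw [add_eq_left] at h
  have := congrArg Fin.val h
  simp at this

theorem ringMap_self (i : Fin (l + 3)) : ringMap u v i v = (i + 1, u) := if_pos rfl

theorem ringMap_of_ne (i : Fin (l + 3)) {x : P} (hx : x ≠ v) : ringMap u v i x = (i, x) :=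
  if_neg hx

theorem ringMap_injective (i : Fin (l + 3)) : Function.Injective (ringMap u v i) := by
  intro x y h
  by_cases hx : x = v <;> by_cases hy : y = v
  · rw [hx, hy]
  · rw [hx, ringMap_self, ringMap_of_ne i hy, Prod.mk.injEq] at h
    exact absurd h.1 (fin_add_one_ne i)
  · rw [hy, ringMap_self, ringMap_of_ne i hx, Prod.mk.injEq] at h
    exact absurd h.1.symm (fin_add_one_ne i)
  · rw [ringMap_of_ne i hx, ringMap_of_ne i hy, Prod.mk.injEq] at h
    exact h.2

/-- Two different copies in the ring have at most one vertex in common. -/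
theorem ringMap_block_unique {i j : Fin (l + 3)} {x y x' y' : P} (hxy : x ≠ y)
    (hx : ringMap u v i x = ringMap u v j x') (hy : ringMap u v i y = ringMap u v j y') :
    i = j := by
  have hxy' : x' ≠ y' := by
    rintro rfl
    exact hxy (ringMap_injective i (hx.trans hy.symm))
  have hi := fin_add_one_add_one_ne i
  have hj := fin_add_one_add_one_ne j
  unfold ringMap at hx hy
  split_ifs at hx hy <;> simp only [Prod.mk.injEq] at hx hy <;> grind

theorem ring_adj_ringMap {B : SimpleGraph P} {i : Fin (l + 3)} {x y : P} :
    (ring u v l B).Adj (ringMap u v i x) (ringMap u v i y) ↔ B.Adj x y := by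
  constructor
  · rintro ⟨hne, j, x', y', h, hx, hy⟩
    obtain rfl := ringMap_block_unique h.ne hx hy
    rwa [ringMap_injective j hx, ringMap_injective j hy] at h
  · intro h
    exact ⟨fun h' => h.ne (ringMap_injective i h'), i, x, y, h, rfl, rfl⟩

theorem ring_comap_ringMap {B : SimpleGraph P} (i : Fin (l + 3)) :
    (ring u v l B).comap (ringMap u v i) = B := by
  ext x y
  exact ring_adj_ringMap

/-- The position in the ring, counted from `i₀`, of a vertex of a copy. -/
theorem val_ringMap_fst_sub {i i₀ : Fin (l + 3)} {x : P}
    (h : ringMap u v i x ≠ (i₀, u)) :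
    ((ringMap u v i x).1 - i₀).val = (i - i₀).val + if x = v then 1 else 0 := by
  by_cases hx : x = v
  · subst hx
    rw [ringMap_self] at h ⊢
    rw [if_pos rfl]
    have h1 : i - i₀ ≠ Fin.last _ := by
      intro h1
      refine h (Prod.ext ?_ rfl)
      have h2 : i - i₀ + 1 = 0 := by rw [h1]; exact Fin.last_add_one _
      rw [sub_add_eq_add_sub, sub_eq_zero] at h2
      exact h2
    rw [show i + 1 - i₀ = i - i₀ + 1 by rw [sub_add_eq_add_sub], Fin.val_add_one, if_neg h1]
  · rw [ringMap_of_ne i hx, if_neg hx]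
    rfl

/-- A copy of $H$ has too few vertices to meet all joints. Cut open at a missed joint `i₀`, the ring
is a chain in which every joint separates. By 2-connectivity $H$ lies on one side of each joint,
hence within the copy of `B` that contains any one of its edges. -/
theorem free_ring [Fintype W] {H : SimpleGraph W} (hH : H.IsKConnected 2) {B : SimpleGraph P}
    (huv : u ≠ v) (hB : H.Free B) (hl : Fintype.card W < l + 3) : H.Free (ring u v l B) := by
  rintro ⟨f⟩
  have : Nontrivial W := Fintype.one_lt_card_iff_nontrivial.1 (by have := hH.2.1; omega)
  have hedge : ∀ a b, H.Adj a b → ∃ i x y, B.Adj x y ∧ ringMap u v i x = f a ∧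
      ringMap u v i y = f b := fun a b hab => (f.toHom.map_adj hab).2
  obtain ⟨i₀, hi₀⟩ : ∃ i₀ : Fin (l + 3), ∀ w, f w ≠ (i₀, u) := by
    by_contra! h
    choose g hg using h
    have hinj : Function.Injective g := fun i j hij => by
      have := (hg i).symm.trans ((congrArg f hij).trans (hg j))
      exact congrArg Prod.fst this
    have := Fintype.card_le_of_injective g hinj
    rw [Fintype.card_fin] at this
    omega
  obtain ⟨w₀⟩ : Nonempty W := inferInstance
  obtain ⟨w₁, hw⟩ := hH.1.preconnected.exists_adj_of_nontrivial w₀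
  obtain ⟨i, x₀, x₁, hx, hx₀, hx₁⟩ := hedge w₀ w₁ hw
  have hpos : ∀ {w j x}, ringMap u v j x = f w →
      ((f w).1 - i₀).val = (j - i₀).val + if x = v then 1 else 0 := by
    intro w j x h
    have := val_ringMap_fst_sub (i₀ := i₀) (h.trans_ne (hi₀ w))
    rwa [h] at this
  -- The sides of joint `k` are told apart by the position counted from `i₀`, which no edge of the
  -- image wraps around.
  have hsep : ∀ k : Fin (l + 3), (∀ w, f w ≠ (k, u) → ((f w).1 - i₀).val < (k - i₀).val) ∨
      ∀ w, f w ≠ (k, u) → ¬ ((f w).1 - i₀).val < (k - i₀).val := by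
    intro k
    refine hH.forall_or_forall_not (S := {w | f w = (k, u)})
      (fun a ha b hb => f.injective (Eq.trans ha (Eq.symm hb))) _ ?_
    intro a b hab ha hb
    obtain ⟨j, x, y, hxy, hxa, hyb⟩ := hedge a b hab
    have hk : ∀ {w z}, f w ≠ (k, u) → ringMap u v j z = f w →
        (((f w).1 - i₀).val < (k - i₀).val ↔ (j - i₀).val < (k - i₀).val) := by
      intro w z hw hz
      rw [hpos hz]
      split_ifs with hzv
      · subst hzv
        have h1 := hpos hz
        rw [if_pos rfl] at h1
        have h2 : (f w).1 ≠ k := by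
          intro h2
          refine hw (Prod.ext h2 ?_)
          rw [← hz, ringMap_self]
        have h3 : ((f w).1 - i₀).val ≠ (k - i₀).val := fun h3 =>
          h2 (sub_left_injective (Fin.ext h3))
        omega
      · rfl
    exact (hk ha hxa).trans (hk hb hyb).symm
  -- The edge $w_0w_1$ decides the side: its two ends lie in copy `i` and cannot both be the joint.
  have hlow : ∀ w, (i - i₀).val ≤ ((f w).1 - i₀).val := by
    intro w
    by_cases hw' : f w = (i, u)
    · rw [hw']
    · rcases hsep i with h | h
      · have h0 := h w₀
        have h1 := h w₁
        rw [hpos hx₀] at h0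
        rw [hpos hx₁] at h1
        have h2 : f w₀ = (i, u) := by_contra fun h2 => by have := h0 h2; omega
        have h3 : f w₁ = (i, u) := by_contra fun h3 => by have := h1 h3; omega
        exact absurd (f.injective (h2.trans h3.symm)) hw.ne
      · exact not_lt.1 (h w hw')
  have hhigh : ∀ w, f w = (i + 1, u) ∨ ((f w).1 - i₀).val ≤ (i - i₀).val := by
    intro w
    by_cases hi : i - i₀ = Fin.last _
    · refine .inr ?_
      rw [hi]
      exact Fin.le_last _
    · have hval : (i + 1 - i₀).val = (i - i₀).val + 1 := by
        rw [show i + 1 - i₀ = i - i₀ + 1 by rw [sub_add_eq_add_sub], Fin.val_add_one, if_neg hi]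
      refine or_iff_not_imp_left.2 fun hw' => ?_
      rcases hsep (i + 1) with h | h
      · have := h w hw'
        omega
      · have key : ∀ {w x}, ringMap u v i x = f w → f w = (i + 1, u) := by
          intro w x hxw
          by_cases hxv : x = v
          · rw [← hxw, hxv, ringMap_self]
          · by_contra h2
            have h3 := h w h2
            rw [hpos hxw, if_neg hxv] at h3
            omega
        exact absurd (f.injective ((key hx₀).trans (key hx₁).symm)) hw.ne
  have hblock : ∀ w, ∃ x, ringMap u v i x = f w := by
    intro w
    rcases hhigh w with h | h
    · exact ⟨v, by rw [ringMap_self, h]⟩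
    · have h1 : (f w).1 = i := sub_left_injective (Fin.ext (le_antisymm h (hlow w)))
      -- A neighbor of `w` excludes that `f w` is the isolated pair `(i, v)`.
      obtain ⟨w', hww'⟩ := hH.1.preconnected.exists_adj_of_nontrivial w
      obtain ⟨j, x, y, -, hxw, -⟩ := hedge w w' hww'
      by_cases hxv : x = v
      · refine ⟨u, ?_⟩
        rw [ringMap_of_ne i huv, ← h1, ← hxw, hxv, ringMap_self]
      · refine ⟨x, ?_⟩
        rw [ringMap_of_ne i hxv, ← h1, ← hxw, ringMap_of_ne j hxv]
  choose g hg using hblock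
  refine hB ⟨⟨⟨g, fun {a b} hab => ?_⟩, fun a b hab => ?_⟩⟩
  · have := f.toHom.map_adj hab
    change (ring u v l B).Adj (f a) (f b) at this
    rwa [← hg, ← hg, ring_adj_ringMap] at this
  · have h1 := hg a
    have h2 := hg b
    rw [show g a = g b from hab] at h1
    exact f.injective (h1.symm.trans h2)

end Ring

end SimpleGraph

/-! ### Existence of gadgets -/

namespace SimpleGraph

variable {V W P : Type*}

section Ring

variable {l : ℕ} [DecidableEq P] {u v : P}

/-- With no red edge at `u`, a joint receives red edges only from the copy that has it as its `v`,
so red degrees never add up across copies. -/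
theorem exists_neighborSet_ring_subset {R : SimpleGraph P} (hu : R.neighborSet u = ∅)
    (a : Fin (l + 3) × P) :
    ∃ i x, (ring u v l R).neighborSet a ⊆ ringMap u v i '' R.neighborSet x := by
  obtain ⟨k, p⟩ := a
  by_cases hp : p = u
  · refine ⟨k - 1, v, ?_⟩
    rintro b ⟨-, i, x, y, hxy, hx, rfl⟩
    by_cases hxv : x = v
    · subst hxv
      rw [ringMap_self, Prod.mk.injEq] at hx
      rw [← hx.1, add_sub_cancel_right]
      exact ⟨y, hxy, rfl⟩
    · rw [ringMap_of_ne i hxv, Prod.mk.injEq] at hx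
      have : y ∈ R.neighborSet u := by rw [← hp, ← hx.2]; exact hxy
      rw [hu] at this
      exact this.elim
  · refine ⟨k, p, ?_⟩
    rintro b ⟨-, i, x, y, hxy, hx, rfl⟩
    by_cases hxv : x = v
    · subst hxv
      rw [ringMap_self, Prod.mk.injEq] at hx
      exact absurd hx.2.symm hp
    · rw [ringMap_of_ne i hxv, Prod.mk.injEq] at hx
      obtain ⟨rfl, rfl⟩ := hx
      exact ⟨y, hxy, rfl⟩

theorem IsGoodRed.ring [Fintype W] [Finite P] {H : SimpleGraph W} (hH : H.IsKConnected 2) {n : ℕ}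
    {B R : SimpleGraph P} (h : IsGoodRed n H B R) (huv : u ≠ v) (hu : R.neighborSet u = ∅)
    (hl : Fintype.card W < l + 3) : IsGoodRed n H (ring u v l B) (ring u v l R) where
  le := fun _ _ ⟨hne, i, x, y, hxy, hx, hy⟩ => ⟨hne, i, x, y, h.le hxy, hx, hy⟩
  degree_lt a := by
    obtain ⟨i, x, hix⟩ := exists_neighborSet_ring_subset (l := l) (v := v) hu a
    refine (Set.ncard_le_ncard hix (Set.toFinite _)).trans_lt ?_
    rw [Set.ncard_image_of_injective _ (ringMap_injective i)]
    exact h.degree_lt x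
  free := fun hc => free_ring hH huv h.free hl (hc.mono_right
    fun _ _ ⟨⟨hne, i, x, y, hxy, hx, hy⟩, hn⟩ =>
      ⟨hne, i, x, y, ⟨hxy, fun hR => hn ⟨hne, i, x, y, hR, hx, hy⟩⟩, hx, hy⟩)

/-- If each good coloring of `B` saturates one of the two terminals, then each good coloring of
the ring saturates all vertices where the copies are joined. -/
theorem le_ncard_neighborSet_of_ring [Finite P] {H : SimpleGraph W} {n : ℕ} (hn : 3 ≤ n)
    {B : SimpleGraph P} (huv : u ≠ v)
    (hB : ∀ R, IsGoodRed n H B R →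
      n - 1 ≤ (R.neighborSet u).ncard ∨ n - 1 ≤ (R.neighborSet v).ncard)
    {R : SimpleGraph (Fin (l + 3) × P)} (hR : IsGoodRed n H (SimpleGraph.ring u v l B) R) :
    n - 1 ≤ (R.neighborSet (0, u)).ncard := by
  have hsat : ∀ i, ∃ k, (k = i ∧ n - 1 ≤ ((R.comap (ringMap u v i)).neighborSet u).ncard) ∨
      (k = i + 1 ∧ n - 1 ≤ ((R.comap (ringMap u v i)).neighborSet v).ncard) := by
    intro i
    have h := hR.comap (ringMap_injective (u := u) (v := v) i)
    rw [ring_comap_ringMap] at h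
    rcases hB _ h with h | h
    · exact ⟨i, .inl ⟨rfl, h⟩⟩
    · exact ⟨i + 1, .inr ⟨rfl, h⟩⟩
  choose s hs using hsat
  -- A joint saturated from both sides would have $2(n-1)\ge n$ red edges.
  have hexcl : ∀ i, n - 1 ≤ ((R.comap (ringMap u v (i + 1))).neighborSet u).ncard →
      n - 1 ≤ ((R.comap (ringMap u v i)).neighborSet v).ncard → False := by
    intro i h1 h2
    have h3 := ncard_neighborSet_comap_add_le (ringMap_injective (u := u) (v := v) (i + 1))
      (ringMap_injective (u := u) (v := v) i) R (x := u) (y := v) (z := (i + 1, u))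
      (ringMap_of_ne _ huv) (ringMap_self i) (by
        intro p q hp hq h
        rw [ringMap_of_ne i hq] at h
        by_cases hpv : p = v
        · rw [hpv, ringMap_self, Prod.mk.injEq] at h
          exact fin_add_one_add_one_ne i h.1
        · rw [ringMap_of_ne _ hpv, Prod.mk.injEq] at h
          exact fin_add_one_ne i h.1)
    have h4 := hR.degree_lt (i + 1, u)
    omega
  -- `s` picks for each copy a joint that it saturates. There are as many joints as copies, so
  -- injectivity means that joint `0` is picked as well.
  have hinj : Function.Injective s := by
    intro i j hij
    rcases hs i with ⟨h1, h2⟩ | ⟨h1, h2⟩ <;> rcases hs j with ⟨h3, h4⟩ | ⟨h3, h4⟩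
    · rw [← h1, ← h3, hij]
    · obtain rfl : i = j + 1 := by rw [← h1, ← h3, hij]
      exact (hexcl j h2 h4).elim
    · obtain rfl : j = i + 1 := by rw [← h1, ← h3, hij]
      exact (hexcl i h4 h2).elim
    · exact add_right_cancel (h1.symm.trans (hij.trans h3))
  obtain ⟨i, hi⟩ := (Finite.injective_iff_surjective.1 hinj) 0
  rcases hs i with ⟨h1, h2⟩ | ⟨h1, h2⟩
  · rw [hi] at h1
    subst h1
    refine h2.trans ((ncard_neighborSet_comap_le (ringMap_injective _) R u).trans_eq ?_)
    rw [ringMap_of_ne _ huv]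
  · rw [hi] at h1
    refine h2.trans ((ncard_neighborSet_comap_le (ringMap_injective _) R v).trans_eq ?_)
    rw [ringMap_self, ← h1]

end Ring

/-! ### Minimal arrowing graphs and the resulting gadgets -/

/-- Greedy choice: each chosen vertex rules out at most `n` vertices, itself and its fewer than `n`
neighbors. -/
theorem exists_indep_of_degree_lt {N n : ℕ} (hn : 0 < n) {R : SimpleGraph (Fin N)}
    (hR : ∀ v, (R.neighborSet v).ncard < n) (k : ℕ) (hk : k * n ≤ N) :
    ∃ S : Finset (Fin N), S.card = k ∧ ∀ x ∈ S, ∀ y ∈ S, ¬ R.Adj x y := by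
  classical
  induction k with
  | zero => exact ⟨∅, rfl, by simp⟩
  | succ k ih =>
    rw [Nat.succ_mul] at hk
    obtain ⟨S, hS, hind⟩ := ih (by omega)
    let T : Finset (Fin N) := S.biUnion fun x => insert x (R.neighborSet x).toFinset
    have hT : T.card ≤ k * n := by
      rw [← hS]
      refine Finset.card_biUnion_le_card_mul _ _ _ fun x _ => (Finset.card_insert_le _ _).trans ?_
      rw [← Set.ncard_eq_toFinset_card']
      exact hR x
    obtain ⟨z, hz⟩ : ∃ z, z ∉ T := by
      by_contra! h
      have h1 := Finset.card_le_card (fun x _ => h x : Finset.univ ⊆ T)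
      rw [Finset.card_univ, Fintype.card_fin] at h1
      omega
    have hz' : ∀ x ∈ S, z ≠ x ∧ ¬ R.Adj x z := by
      intro x hx
      simp only [T, Finset.mem_biUnion, Finset.mem_insert, Set.mem_toFinset, mem_neighborSet,
        not_exists, not_and, not_or] at hz
      exact hz x hx
    refine ⟨insert z S, ?_, ?_⟩
    · rw [Finset.card_insert_of_notMem fun h => (hz' z h).1 rfl, hS]
    · intro x hx y hy
      rcases Finset.mem_insert.1 hx with hxz | hx <;> rcases Finset.mem_insert.1 hy with hyz | hy
      · rw [hxz, hyz]
        exact R.irrefl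
      · rw [hxz]
        exact fun h => (hz' y hy).2 h.symm
      · rw [hyz]
        exact (hz' x hx).2
      · exact hind x hx y hy

/-- A red-independent set of $|W|$ vertices in a complete graph spans a blue clique, which contains
$H$. -/
theorem exists_arrows [Fintype W] (H : SimpleGraph W) {n : ℕ} (hn : 0 < n) :
    (⊤ : SimpleGraph (Fin (Fintype.card W * n))).Arrows (starK n) H := by
  classical
  rw [arrows_starK_iff]
  intro R hR
  obtain ⟨S, hS, hind⟩ := exists_indep_of_degree_lt hn hR.degree_lt (Fintype.card W) le_rfl
  have e : W ≃ S := Fintype.equivOfCardEq (by rw [Fintype.card_coe, hS])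
  refine hR.free ⟨⟨⟨fun w => (e w : Fin _), fun {a b} hab => ?_⟩, ?_⟩⟩
  · exact ⟨fun h => hab.ne (e.injective (Subtype.ext h)), hind _ (e a).2 _ (e b).2⟩
  · exact Subtype.val_injective.comp e.injective

theorem ncard_neighborSet_sup_edge_le {R : SimpleGraph V} [Finite V] (u v x : V) :
    ((R ⊔ edge u v).neighborSet x).ncard ≤ (R.neighborSet x).ncard + 1 := by
  classical
  have : (R ⊔ edge u v).neighborSet x ⊆ insert (if x = u then v else u) (R.neighborSet x) := by
    intro y
    simp only [mem_neighborSet, sup_adj, edge_adj, Set.mem_insert_iff]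
    grind
  exact (Set.ncard_le_ncard this (Set.toFinite _)).trans (Set.ncard_insert_le _ _)

/-- There is a graph with two terminals in which each good coloring saturates one of them. -/
theorem exists_or_saturated [Fintype W] {H : SimpleGraph W} (hH : H.IsKConnected 2) {n : ℕ}
    (hn : 3 ≤ n) : ∃ (N : ℕ) (B : SimpleGraph (Fin N)) (u v : Fin N), u ≠ v ∧
      (∃ R, IsGoodRed n H B R) ∧ ∀ R, IsGoodRed n H B R →
        n - 1 ≤ (R.neighborSet u).ncard ∨ n - 1 ≤ (R.neighborSet v).ncard := by
  classical
  have : Nontrivial W := Fintype.one_lt_card_iff_nontrivial.1 (by have := hH.2.1; omega)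
  obtain ⟨J, hJ, hmin⟩ := (Set.toFinite
    {G : SimpleGraph (Fin (Fintype.card W * n)) | G.Arrows (starK n) H}).exists_minimal
      ⟨⊤, exists_arrows H (by omega)⟩
  have hne : J ≠ ⊥ := by
    rintro rfl
    refine (arrows_starK_iff.1 hJ) ⊥ ⟨le_rfl, fun v => ?_, ?_⟩
    · simp; omega
    · rw [sdiff_self]
      refine free_bot fun h => ?_
      obtain ⟨w⟩ : Nonempty W := inferInstance
      obtain ⟨w', h'⟩ := hH.1.preconnected.exists_adj_of_nontrivial w
      rw [h] at h'
      exact h'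
  obtain ⟨u, v, huv⟩ := ne_bot_iff_exists_adj.1 hne
  refine ⟨_, J \ edge u v, u, v, huv.ne, ?_, fun R hR => ?_⟩
  · by_contra hno
    have hle := hmin (y := J \ edge u v) (arrows_starK_iff.2 (not_exists.1 hno)) sdiff_le huv
    exact hle.2 (by simp [edge_adj, huv.ne])
  · by_contra hcon
    push Not at hcon
    -- Restoring $uv$ in red leaves the blue graph unchanged and raises red degrees only at `u` and
    -- `v`, where there is still room.
    refine (arrows_starK_iff.1 hJ) (R ⊔ edge u v)
      ⟨sup_le (hR.le.trans sdiff_le) ((edge_le_iff _).2 (.inr huv)), fun x => ?_, ?_⟩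
    · by_cases hx : x = u ∨ x = v
      · have h1 := ncard_neighborSet_sup_edge_le (R := R) u v x
        rcases hx with rfl | rfl <;> omega
      · have : (R ⊔ edge u v).neighborSet x = R.neighborSet x := by
          ext y
          simp only [mem_neighborSet, sup_adj, edge_adj]
          tauto
        rw [this]
        exact hR.degree_lt x
    · rw [sup_comm, ← sdiff_sdiff_left]
      exact hR.free

/-- There is a gadget that forces at least one red edge. -/
theorem exists_isGadget [Fintype W] {H : SimpleGraph W} (hH : H.IsKConnected 2) {n : ℕ}
    (hn : 3 ≤ n) : ∃ (N : ℕ) (A : SimpleGraph (Fin N)) (r : Fin N) (m : ℕ),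
      1 ≤ m ∧ m < n ∧ IsGadget n H A r m := by
  obtain ⟨N, B, u, v, huv, ⟨R₁, hR₁⟩, hB⟩ := exists_or_saturated hH hn
  -- A good coloring without red edges at `u` can be repeated around the ring; if there is none, `u`
  -- itself serves as root.
  by_cases hex : ∃ R, IsGoodRed n H B R ∧ (R.neighborSet u).ncard = 0
  · obtain ⟨R, hR, hu⟩ := hex
    rw [Set.ncard_eq_zero] at hu
    have hgood := hR.ring (l := Fintype.card W) hH huv hu (by omega)
    obtain ⟨m, h1, h2, h3⟩ := exists_isGadget_of_pos hgood
      (fun R hR => le_trans (by omega) (le_ncard_neighborSet_of_ring hn huv hB hR))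
    have e : Fin (Fintype.card (Fin (Fintype.card W + 3) × Fin N)) ≃
      Fin (Fintype.card W + 3) × Fin N := (Fintype.equivFin _).symm
    exact ⟨_, _, _, m, h1, h2, h3.comap_equiv e⟩
  · push Not at hex
    obtain ⟨m, h⟩ := exists_isGadget_of_pos hR₁ fun R hR => Nat.one_le_iff_ne_zero.2 (hex R hR)
    exact ⟨N, B, u, m, h⟩

/-- The finite graph $H$ does not embed in a graph with fewer edges. -/
theorem free_sdiff_edge [Finite W] {H : SimpleGraph W} {v w : W} (hvw : H.Adj v w) :
    H.Free (H \ edge v w) := by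
  rintro ⟨f⟩
  have h1 := Nat.card_le_card_of_injective f.mapEdgeSet f.mapEdgeSet.injective
  have h2 : (H \ edge v w).edgeSet ⊂ H.edgeSet := by
    refine edgeSet_ssubset_edgeSet.2 (lt_of_le_of_ne sdiff_le fun h => ?_)
    have h3 : (H \ edge v w).Adj v w := by rw [h]; exact hvw
    exact h3.2 (by simp [edge_adj, hvw.ne])
  have h3 := Set.ncard_lt_ncard h2 (Set.toFinite _)
  rw [← Nat.card_coe_set_eq, ← Nat.card_coe_set_eq] at h3
  omega

theorem neighborSet_edge {v w : V} (hvw : v ≠ w) : (edge v w).neighborSet v = {w} := by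
  ext x
  simp only [mem_neighborSet, edge_adj, Set.mem_singleton_iff]
  grind

/-- From a gadget that forces `n - 1` red edges, a gadget that forces one red edge. -/
theorem IsGadget.exists_one [Fintype W] [Finite P] {H : SimpleGraph W} (hH : H.IsKConnected 2)
    {n : ℕ} (hn : 3 ≤ n) {A : SimpleGraph P} {r : P} (h : IsGadget n H A r (n - 1)) :
    ∃ (v : W) (A' : SimpleGraph (W × P)), IsGadget n H A' (v, r) 1 := by
  classical
  have : Nontrivial W := Fintype.one_lt_card_iff_nontrivial.1 (by have := hH.2.1; omega)
  obtain ⟨v⟩ : Nonempty W := inferInstance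
  obtain ⟨w, hvw⟩ := hH.1.preconnected.exists_adj_of_nontrivial v
  have hbot : H ≠ ⊥ := fun h => by rw [h] at hvw; exact hvw
  -- Only `v` and `w` carry no gadget, so `vw` is the only edge of $H$ that can be red; since $H$
  -- cannot be entirely blue, it must be.
  let A' : W → SimpleGraph P := fun i => if i = v ∨ i = w then ⊥ else A
  refine ⟨v, H.attach A' r, fun R hR => ?_, ?_⟩
  · have hroot := hR.comap (mk_right_injective r)
    rw [attach_comap_root] at hroot
    have hiso : ∀ x y, x ≠ v → x ≠ w → ¬ R.Adj (x, r) (y, r) := by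
      intro x y hxv hxw hxy
      have hfiber := hR.comap (mk_left_injective x)
      rw [attach_comap_fiber, show A' x = A by simp [A', hxv, hxw]] at hfiber
      have h1 := h.le_degree _ hfiber
      have h2 := ncard_root_add_ncard_fiber_le R x r
      have h3 := hR.degree_lt (x, r)
      have h4 : 0 < ((R.comap fun i => (i, r)).neighborSet x).ncard :=
        (Set.ncard_pos (Set.toFinite _)).2 ⟨y, hxy⟩
      omega
    have hred : R.Adj (v, r) (w, r) := by
      by_contra hno
      refine hroot.free (IsContained.of_le fun x y hxy => ⟨hxy, fun hxy' => ?_⟩)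
      have hxy' : R.Adj (x, r) (y, r) := hxy'
      have hne : x ≠ y := hxy.ne
      have hx : x = v ∨ x = w := by
        by_contra hx
        push Not at hx
        exact hiso x y hx.1 hx.2 hxy'
      have hy : y = v ∨ y = w := by
        by_contra hy
        push Not at hy
        exact hiso y x hy.1 hy.2 hxy'.symm
      rcases hx with rfl | rfl <;> rcases hy with rfl | rfl
      · exact hne rfl
      · exact hno hxy'
      · exact hno hxy'.symm
      · exact hne rfl
    exact (Set.ncard_pos (Set.toFinite _)).2 ⟨(w, r), hred⟩
  · obtain ⟨S, hS, hm⟩ := h.exists_degree_eq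
    let S' : W → SimpleGraph P := fun i => if i = v ∨ i = w then ⊥ else S
    have hS' : ∀ i, IsGoodRed n H (A' i) (S' i) := by
      intro i
      by_cases hi : i = v ∨ i = w
      · simp only [A', S', if_pos hi]
        refine ⟨le_rfl, fun x => ?_, ?_⟩
        · simp; omega
        · rw [sdiff_self]
          exact free_bot hbot
      · simp only [A', S', if_neg hi]
        exact hS
    have hSv : (S' v).neighborSet r = ∅ := by simp [S']
    have hSw : (S' w).neighborSet r = ∅ := by simp [S']
    refine ⟨_, IsGoodRed.attach (r := r) hH (R := edge v w) ((edge_le_iff _).2 (.inr hvw))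
      (free_sdiff_edge hvw) hS' fun i => ?_, ?_⟩
    · by_cases hi : i = v ∨ i = w
      · rcases hi with rfl | rfl
        · rw [hSv, neighborSet_edge hvw.ne, Set.ncard_singleton, Set.ncard_empty]
          omega
        · rw [hSw, edge_comm, neighborSet_edge hvw.ne', Set.ncard_singleton, Set.ncard_empty]
          omega
      · have h1 : (edge v w).neighborSet i = ∅ := by
          ext x
          simp only [mem_neighborSet, edge_adj, Set.mem_empty_iff_false]
          tauto
        rw [h1, Set.ncard_empty, Nat.zero_add]
        exact (hS' i).degree_lt r
    · rw [neighborSet_attach_root, hSv, neighborSet_edge hvw.ne]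
      simp

/-- There is a gadget that forces between `1` and `n - 2` red edges. -/
theorem exists_isGadget_le [Fintype W] {H : SimpleGraph W} (hH : H.IsKConnected 2) {n : ℕ}
    (hn : 3 ≤ n) : ∃ (N : ℕ) (A : SimpleGraph (Fin N)) (r : Fin N) (m : ℕ),
      1 ≤ m ∧ m + 2 ≤ n ∧ IsGadget n H A r m := by
  obtain ⟨N, A, r, m, h1, h2, h⟩ := exists_isGadget hH hn
  by_cases hm : m + 2 ≤ n
  · exact ⟨N, A, r, m, h1, hm, h⟩
  · obtain rfl : m = n - 1 := by omega
    obtain ⟨v, A', h'⟩ := h.exists_one hH hn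
    have e : Fin (Fintype.card (W × Fin N)) ≃ W × Fin N := (Fintype.equivFin _).symm
    exact ⟨_, _, _, 1, le_rfl, by omega, h'.comap_equiv e⟩

end SimpleGraph

theorem mainTheorem7 {W : Type*} [Fintype W] (H : SimpleGraph W) (hH : H.IsKConnected 2)
    (n : ℕ) (hn : 3 ≤ n)
    (hard : ∀ k : ℕ, 2 ≤ k → k < n → ArrowingIsCoNPHard (starK k) H) :
    ArrowingIsCoNPHard (starK n) H := by
  obtain ⟨a, A, r, m, h1, h2, hA⟩ := SimpleGraph.exists_isGadget_le hH hn
  intro L hL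
  -- The bounds $1\le m\le n-2$ are exactly what puts $n-m$ in the range of `hard`.
  obtain ⟨f, ⟨hf⟩, hfL⟩ := hard (n - m) (by omega) (by omega) L hL
  obtain ⟨hg⟩ := nonempty_computableInPolyTime_attachFin A r
  refine ⟨attachFin A r ∘ f, hf.comp hg, fun x => (hfL x).trans ?_⟩
  exact (hA.arrows_attach_iff hH (f x).2).symm.trans
    (SimpleGraph.arrows_comap_equiv (attachEquiv a (f x).1)).symm
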